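/- Let $k$ be an algebraically closed field of characteristic zero, let $A,B$ be finite-dimensional $k$-vector spaces, and let $M\subset \mathrm{Hom}_k(A,B)$ be a linear subspace of dimension $n+1$ ($n\geq 0$) of constant rank $r$, i.e. every $f\in M$, $f\neq 0$, has rank $r$. Let $\mathbb{P}^n=\mathbb{P}(M)$ be the projective space of lines of $M$, and let $\psi_M: A\otimes\mathcal{O}(-1)\to B\otimes\mathcal{O}$ be the morphism of vector bundles on $\mathbb{P}(M)$ given over the point $\langle f\rangle$ by $v\otimes \lambda f\mapsto \lambda f(v)$. Since $\psi_M$ has rank $r$ at every point, its image $\mathcal{E}_M=\mathrm{Im}(\psi_M)$ and its cokernel $E_M=\mathrm{Coker}(\psi_M)$ are vector bundles, of ranks $r$ and $\dim B-r$. Let $c=c_1(E_M)\in\mathbb{Z}$ be the first Chern class: for $n\geq 1$ it is the unique integer $d$ with $\det E_M\cong\mathcal{O}(d)$, and for $n=0$ it is $0$. Then $0\leq c\leq r$, and $\mathcal{E}_M$ is uniform of splitting type $(-1^{c},0^{r-c})$: for every line $L\subset\mathbb{P}(M)$, $$\mathcal{E}_M|_L\;\cong\; \mathcal{O}_L(-1)^{\oplus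 c}\oplus\mathcal{O}_L^{\oplus (r-c)}.$$ -/

import Mathlib

open Module
open scoped LinearAlgebra.Projectivization TensorProduct Topology

noncomputable section

namespace ProjSpace

/-! ### The Zariski topology and the regular functions of a projective space

`ℙ k V` is the projective space of lines of `V`. Polynomials on `V` are polynomials in the linear
forms of `V`. -/

section Functions

variable {k : Type*} [Field k] {V : Type*} [AddCommGroup V] [Module k V]

/-- The value at `v : V` of a polynomial in the linear forms of `V`. -/
def evalForm (p : MvPolynomial (Dual k V) k) (v : V) : k :=
  MvPolynomial.eval (fun l : Dual k V => l v) p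

@[simp] theorem evalForm_add (p q : MvPolynomial (Dual k V) k) (v : V) :
    evalForm (p + q) v = evalForm p v + evalForm q v := by simp [evalForm]

@[simp] theorem evalForm_mul (p q : MvPolynomial (Dual k V) k) (v : V) :
    evalForm (p * q) v = evalForm p v * evalForm q v := by simp [evalForm]

@[simp] theorem evalForm_C (c : k) (v : V) :
    evalForm (MvPolynomial.C c) v = c := by simp [evalForm]

@[simp] theorem evalForm_X (l : Dual k V) (v : V) :
    evalForm (MvPolynomial.X l) v = l v := by simp [evalForm]

@[simp] theorem evalForm_pow (p : MvPolynomial (Dual k V) k) (m : ℕ) (v : V) :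
    evalForm (p ^ m) v = evalForm p v ^ m := by simp [evalForm]

theorem evalForm_smul {p : MvPolynomial (Dual k V) k} {d : ℕ} (hp : p.IsHomogeneous d)
    (t : k) (v : V) : evalForm p (t • v) = t ^ d * evalForm p v := by
  simp only [evalForm, MvPolynomial.eval_eq, map_smul, smul_eq_mul, mul_pow,
    Finset.prod_mul_distrib, Finset.mul_sum]
  refine Finset.sum_congr rfl fun m hm => ?_
  have h := hp (MvPolynomial.mem_support_iff.mp hm)
  rw [Finset.prod_pow_eq_pow_sum]
  have h' : ∑ i ∈ m.support, m i = d := by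
    rw [← h, Finsupp.weight_apply, Finsupp.sum]; simp
  rw [h']; ring

/-- The Zariski topology: the sets `q ≠ 0`, with `q` a homogeneous polynomial, are a basis. -/
@[reducible] def zariski (k : Type*) [Field k] (V : Type*) [AddCommGroup V] [Module k V] :
    TopologicalSpace (ℙ k V) where
  IsOpen U := ∀ x ∈ U, ∃ (d : ℕ) (q : MvPolynomial (Dual k V) k), q.IsHomogeneous d ∧
    evalForm q x.rep ≠ 0 ∧ ∀ y : ℙ k V, evalForm q y.rep ≠ 0 → y ∈ U
  isOpen_univ x _ := ⟨0, 1, MvPolynomial.isHomogeneous_one _ _, by simp [evalForm], by simp⟩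
  isOpen_inter s t hs ht x hx := by
    obtain ⟨d, q, hq, hqx, h⟩ := hs x hx.1
    obtain ⟨d', q', hq', hqx', h'⟩ := ht x hx.2
    refine ⟨d + d', q * q', hq.mul hq', by simp [hqx, hqx'], fun y hy => ?_⟩
    rw [evalForm_mul] at hy
    exact ⟨h y (left_ne_zero_of_mul hy), h' y (right_ne_zero_of_mul hy)⟩
  isOpen_sUnion S hS x hx := by
    obtain ⟨U, hU, hxU⟩ := hx
    obtain ⟨d, q, hq, hqx, h⟩ := hS U hU x hxU
    exact ⟨d, q, hq, hqx, fun y hy => ⟨U, hU, h y hy⟩⟩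

theorem isOpen_ne_zero {q : MvPolynomial (Dual k V) k} {d : ℕ} (hq : q.IsHomogeneous d) :
    IsOpen[zariski k V] {x : ℙ k V | evalForm q x.rep ≠ 0} :=
  fun _ hx => ⟨d, q, hq, hx, fun _ hy => hy⟩

/-- The functions which are regular on the open set `U`: locally on `U` they are quotients of two
homogeneous polynomials of the same degree. (The values outside `U` are irrelevant.) -/
def regularFunctions (U : Set (ℙ k V)) : Subalgebra k (ℙ k V → k) where
  carrier := {g | ∀ x ∈ U, ∃ (d : ℕ) (p q : MvPolynomial (Dual k V) k),
    p.IsHomogeneous d ∧ q.IsHomogeneous d ∧ evalForm q x.rep ≠ 0 ∧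
    ∀ y ∈ U, evalForm q y.rep ≠ 0 → g y = evalForm p y.rep / evalForm q y.rep}
  mul_mem' := by
    intro g g' hg hg' x hx
    obtain ⟨d, p, q, hp, hq, hqx, h⟩ := hg x hx
    obtain ⟨d', p', q', hp', hq', hqx', h'⟩ := hg' x hx
    refine ⟨d + d', p * p', q * q', hp.mul hp', hq.mul hq', by simp [hqx, hqx'],
      fun y hy hne => ?_⟩
    rw [evalForm_mul] at hne
    rw [Pi.mul_apply, h y hy (left_ne_zero_of_mul hne), h' y hy (right_ne_zero_of_mul hne),
      evalForm_mul, evalForm_mul, div_mul_div_comm]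
  add_mem' := by
    intro g g' hg hg' x hx
    obtain ⟨d, p, q, hp, hq, hqx, h⟩ := hg x hx
    obtain ⟨d', p', q', hp', hq', hqx', h'⟩ := hg' x hx
    refine ⟨d + d', p * q' + q * p', q * q', (hp.mul hq').add (hq.mul hp'), hq.mul hq',
      by simp [hqx, hqx'], fun y hy hne => ?_⟩
    rw [evalForm_mul] at hne
    rw [Pi.add_apply, h y hy (left_ne_zero_of_mul hne), h' y hy (right_ne_zero_of_mul hne),
      div_add_div _ _ (left_ne_zero_of_mul hne) (right_ne_zero_of_mul hne)]
    simp
  algebraMap_mem' c x _ := ⟨0, MvPolynomial.C c, 1, MvPolynomial.isHomogeneous_C _ _,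
    MvPolynomial.isHomogeneous_one _ _, by simp [evalForm], fun y _ _ => by simp [evalForm]⟩

theorem regular_mono {U W : Set (ℙ k V)} (h : W ⊆ U) {g : ℙ k V → k}
    (hg : g ∈ regularFunctions U) : g ∈ regularFunctions W := by
  intro x hx
  obtain ⟨d, p, q, hp, hq, hqx, h'⟩ := hg x (h hx)
  exact ⟨d, p, q, hp, hq, hqx, fun y hy => h' y (h hy)⟩

theorem regular_const (U : Set (ℙ k V)) (c : k) : (fun _ => c) ∈ regularFunctions U :=
  (regularFunctions U).algebraMap_mem c

theorem regular_inv {U : Set (ℙ k V)} {g : ℙ k V → k}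
    (hg : g ∈ regularFunctions U) (h0 : ∀ x ∈ U, g x ≠ 0) :
    (fun x => (g x)⁻¹) ∈ regularFunctions U := by
  intro x hx
  obtain ⟨d, p, q, hp, hq, hqx, h⟩ := hg x hx
  have h1 := h0 x hx
  rw [h x hx hqx] at h1
  have hpx : evalForm p x.rep ≠ 0 := fun h2 => h1 (by rw [h2, zero_div])
  refine ⟨d + d, q * q, p * q, hq.mul hq, hp.mul hq, by simp [hpx, hqx], fun y hy hne => ?_⟩
  rw [evalForm_mul] at hne
  have h3 := right_ne_zero_of_mul hne
  have h4 := left_ne_zero_of_mul hne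
  change (g y)⁻¹ = _
  rw [h y hy h3]
  simp only [evalForm_mul]
  field_simp

theorem regular_congr {U : Set (ℙ k V)} {g g' : ℙ k V → k}
    (hg : g ∈ regularFunctions U) (h : ∀ x ∈ U, g x = g' x) : g' ∈ regularFunctions U := by
  intro x hx
  obtain ⟨d, p, q, hp, hq, hqx, h'⟩ := hg x hx
  exact ⟨d, p, q, hp, hq, hqx, fun y hy hne => (h y hy) ▸ h' y hy hne⟩

theorem regular_ratio (U : Set (ℙ k V)) (l l' : Dual k V) (h0 : ∀ x ∈ U, l' x.rep ≠ 0) :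
    (fun x : ℙ k V => l x.rep / l' x.rep) ∈ regularFunctions U :=
  fun x hx => ⟨1, MvPolynomial.X l, MvPolynomial.X l', MvPolynomial.isHomogeneous_X _ _,
    MvPolynomial.isHomogeneous_X _ _, by simpa using h0 x hx, fun y _ _ => by simp⟩

theorem regular_zpow {U : Set (ℙ k V)} {g : ℙ k V → k}
    (hg : g ∈ regularFunctions U) (h0 : ∀ x ∈ U, g x ≠ 0) (d : ℤ) :
    (fun x => g x ^ d) ∈ regularFunctions U := by
  obtain ⟨m, rfl | rfl⟩ := d.eq_nat_or_neg
  · have := (regularFunctions U).pow_mem hg m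
    refine regular_congr this fun x _ => by simp
  · have := (regularFunctions U).pow_mem (regular_inv hg h0) m
    refine regular_congr this fun x _ => by simp

theorem regular_det {κ : Type*} [Fintype κ] [DecidableEq κ] {U : Set (ℙ k V)}
    {G : κ → κ → ℙ k V → k} (hG : ∀ a b, G a b ∈ regularFunctions U) :
    (fun x => (Matrix.of fun a b => G a b x).det) ∈ regularFunctions U := by
  have : (fun x => (Matrix.of fun a b => G a b x).det) =
      ∑ σ : Equiv.Perm κ, (Equiv.Perm.sign σ : ℤ) • ∏ i, G (σ i) i := by
    funext x
    simp [Matrix.det_apply, Finset.sum_apply, Finset.prod_apply, Units.smul_def]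
  rw [this]
  exact sum_mem fun σ _ => zsmul_mem (prod_mem fun i _ => hG _ _) _

theorem regular_sum_mul {κ : Type*} [Fintype κ] {U : Set (ℙ k V)}
    {g h : κ → ℙ k V → k} (hg : ∀ a, g a ∈ regularFunctions U)
    (hh : ∀ a, h a ∈ regularFunctions U) :
    (fun x => ∑ a, g a x * h a x) ∈ regularFunctions U := by
  have : (fun x => ∑ a, g a x * h a x) = ∑ a, g a * h a := by
    funext x; simp [Finset.sum_apply]
  rw [this]
  exact sum_mem fun a _ => mul_mem (hg a) (hh a)

theorem isOpen_regular_ne_zero {U : Set (ℙ k V)} (hU : IsOpen[zariski k V] U) {g : ℙ k V → k}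
    (hg : g ∈ regularFunctions U) : IsOpen[zariski k V] {x | x ∈ U ∧ g x ≠ 0} := by
  intro x hx
  obtain ⟨d, p, q, hp, hq, hqx, h⟩ := hg x hx.1
  obtain ⟨d', q', hq', hqx', h'⟩ := hU x hx.1
  have h1 := hx.2
  rw [h x hx.1 hqx] at h1
  have hpx : evalForm p x.rep ≠ 0 := fun h2 => h1 (by rw [h2, zero_div])
  refine ⟨_, p * q * q', (hp.mul hq).mul hq', by simp [hpx, hqx, hqx'], fun y hy => ?_⟩
  simp only [evalForm_mul] at hy
  have h2 := right_ne_zero_of_mul hy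
  have h3 := left_ne_zero_of_mul hy
  have hyU := h' y h2
  refine ⟨hyU, ?_⟩
  rw [h y hyU (right_ne_zero_of_mul h3)]
  exact div_ne_zero (left_ne_zero_of_mul h3) (right_ne_zero_of_mul h3)

end Functions

/-! ### Algebraic vector bundles on a projective space -/

/-- An algebraic vector bundle of rank `r` on `ℙ k V`: a family of vector spaces over the points,
with an atlas of frames over the members of a Zariski open covering, such that the transition
matrices between any two of these frames have regular entries. -/
structure VecBundle (k : Type*) [Field k] (V : Type*) [AddCommGroup V] [Module k V] (r : ℕ) where
  Fiber : ℙ k V → Type*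
  [acg : ∀ x, AddCommGroup (Fiber x)]
  [mod : ∀ x, Module k (Fiber x)]
  ι : Type*
  base : ι → Set (ℙ k V)
  isOpen_base : ∀ i, IsOpen[zariski k V] (base i)
  cover : ∀ x, ∃ i, x ∈ base i
  frame : ι → ∀ x, Fin r → Fiber x
  indep : ∀ i, ∀ x ∈ base i, LinearIndependent k (frame i x)
  span : ∀ i, ∀ x ∈ base i, Submodule.span k (Set.range (frame i x)) = ⊤
  transition : ∀ i j, ∃ G : Fin r → Fin r → ℙ k V → k,
    (∀ b a, G b a ∈ regularFunctions (base i ∩ base j)) ∧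
    ∀ x ∈ base i ∩ base j, ∀ a, frame i x a = ∑ b, G b a x • frame j x b

attribute [instance] VecBundle.acg VecBundle.mod

section Bundles

variable {k : Type*} [Field k] {V : Type*} [AddCommGroup V] [Module k V]

/-- The basis of the fibre given by a frame. -/
def VecBundle.basis {r : ℕ} (E : VecBundle k V r) (i : E.ι) (x : ℙ k V) (hx : x ∈ E.base i) :
    Basis (Fin r) k (E.Fiber x) :=
  Basis.mk (E.indep i x hx) (E.span i x hx).ge

@[simp] theorem VecBundle.basis_apply {r : ℕ} (E : VecBundle k V r) (i : E.ι) (x : ℙ k V)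
    (hx : x ∈ E.base i) (a : Fin r) : E.basis i x hx a = E.frame i x a := by
  simp [VecBundle.basis]

theorem VecBundle.finite_fiber {r : ℕ} (E : VecBundle k V r) (x : ℙ k V) :
    Module.Finite k (E.Fiber x) := by
  obtain ⟨i, hi⟩ := E.cover x
  exact Module.Finite.of_basis (E.basis i x hi)

theorem VecBundle.finrank_fiber {r : ℕ} (E : VecBundle k V r) (x : ℙ k V) :
    finrank k (E.Fiber x) = r := by
  obtain ⟨i, hi⟩ := E.cover x
  simpa using finrank_eq_card_basis (E.basis i x hi)

/-- A morphism of vector bundles: a family of linear maps between the fibres, given in frames by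
matrices of regular functions. -/
structure Hom {e f : ℕ} (E : VecBundle k V e) (F : VecBundle k V f) where
  toFun : ∀ x, E.Fiber x →ₗ[k] F.Fiber x
  regular : ∀ i j, ∃ G : Fin f → Fin e → ℙ k V → k,
    (∀ b a, G b a ∈ regularFunctions (E.base i ∩ F.base j)) ∧
    ∀ x ∈ E.base i ∩ F.base j, ∀ a,
      toFun x (E.frame i x a) = ∑ b, G b a x • F.frame j x b

/-- Two vector bundles are isomorphic: there are two mutually inverse morphisms. -/
def Isomorphic {e f : ℕ} (E : VecBundle k V e) (F : VecBundle k V f) : Prop :=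
  ∃ (φ : Hom E F) (ψ : Hom F E),
    (∀ x, ψ.toFun x ∘ₗ φ.toFun x = LinearMap.id) ∧ ∀ x, φ.toFun x ∘ₗ ψ.toFun x = LinearMap.id

/-! #### The line bundles `𝒪(d)` -/

/-- The fibre of `𝒪(d)` at the line `x` of `V`: the functions on `x ∖ {0}` which are homogeneous
of degree `d`. For `d = -1`, a vector of the line `x` is the same thing as such a function `h`,
namely the vector `h(v) v`, which does not depend on the nonzero vector `v` of `x`. -/
def twistFiber (d : ℤ) (x : ℙ k V) : Submodule k ({v : V // v ≠ 0 ∧ v ∈ x.submodule} → k) where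
  carrier := {h | ∀ (v w : {v : V // v ≠ 0 ∧ v ∈ x.submodule}) (t : k),
    (w : V) = t • (v : V) → h w = t ^ d * h v}
  add_mem' := by
    intro h h' hh hh' v w t e
    rw [Pi.add_apply, Pi.add_apply, hh v w t e, hh' v w t e, mul_add]
  zero_mem' := by intro v w t _; simp
  smul_mem' := by
    intro c h hh v w t e
    rw [Pi.smul_apply, Pi.smul_apply, hh v w t e, smul_eq_mul, smul_eq_mul]; ring

/-- The vector `x.rep`, seen as a nonzero vector of the line `x`. -/
def repMem (x : ℙ k V) : {v : V // v ≠ 0 ∧ v ∈ x.submodule} :=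
  ⟨x.rep, x.rep_nonzero, by rw [x.submodule_eq]; exact Submodule.mem_span_singleton_self _⟩

theorem exists_smul_rep {x : ℙ k V} (v : {v : V // v ≠ 0 ∧ v ∈ x.submodule}) :
    ∃ t : k, t ≠ 0 ∧ (v : V) = t • x.rep := by
  obtain ⟨t, ht⟩ := Submodule.mem_span_singleton.mp (x.submodule_eq.le v.2.2)
  refine ⟨t, fun h0 => v.2.1 ?_, ht.symm⟩
  rw [← ht, h0, zero_smul]

/-- The element `l ^ d` of the fibre of `𝒪(d)`, for a linear form `l`. -/
def twistFrame (d : ℤ) (l : Dual k V) (x : ℙ k V) : twistFiber (k := k) d x :=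
  ⟨fun v => l v.1 ^ d, by
    intro v w t e
    dsimp only
    rw [e, map_smul, smul_eq_mul, mul_zpow]⟩

theorem twist_ext {d : ℤ} {x : ℙ k V} {h h' : twistFiber (k := k) d x}
    (e : h.1 (repMem x) = h'.1 (repMem x)) : h = h' := by
  apply Subtype.ext
  funext v
  obtain ⟨t, _, ht⟩ := exists_smul_rep v
  rw [h.2 (repMem x) v t ht, h'.2 (repMem x) v t ht, e]

theorem exists_dual_rep (x : ℙ k V) : ∃ l : Dual k V, l x.rep ≠ 0 := by
  by_contra hcon
  push Not at hcon
  exact x.rep_nonzero ((Module.forall_dual_apply_eq_zero_iff k x.rep).mp hcon)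

/-- The line bundle `𝒪(d)`. Over the open set `l ≠ 0` it has the frame `l ^ d`. -/
def twist (k : Type*) [Field k] (V : Type*) [AddCommGroup V] [Module k V] (d : ℤ) :
    VecBundle k V 1 where
  Fiber x := twistFiber d x
  ι := Dual k V
  base l := {x | l x.rep ≠ 0}
  isOpen_base l := by
    have := isOpen_ne_zero (MvPolynomial.isHomogeneous_X k l)
    simpa using this
  cover x := exists_dual_rep x
  frame l x _ := twistFrame d l x
  indep l x hx := by
    rw [linearIndependent_unique_iff]
    intro h
    have h1 := congrFun (congrArg Subtype.val h) (repMem x)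
    exact zpow_ne_zero d hx h1
  span l x hx := by
    rw [eq_top_iff]
    intro h _
    rw [Set.range_const, Submodule.mem_span_singleton]
    refine ⟨h.1 (repMem x) / l x.rep ^ d, twist_ext ?_⟩
    exact div_mul_cancel₀ _ (zpow_ne_zero d hx)
  transition l l' := by
    refine ⟨fun _ _ x => (l x.rep / l' x.rep) ^ d, fun _ _ => ?_, fun x hx a => ?_⟩
    · refine regular_zpow (regular_ratio _ l l' fun x hx => hx.2) (fun x hx => ?_) d
      exact div_ne_zero hx.1 hx.2
    · rw [Fin.sum_univ_one]
      refine twist_ext ?_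
      change l x.rep ^ d = (l x.rep / l' x.rep) ^ d * l' x.rep ^ d
      rw [← mul_zpow, div_mul_cancel₀ _ hx.2]

/-! #### Operations on vector bundles -/

/-- The trivial bundle `B ⊗ 𝒪`. -/
def trivialBundle (k : Type*) [Field k] (V : Type*) [AddCommGroup V] [Module k V]
    (B : Type*) [AddCommGroup B] [Module k B] [FiniteDimensional k B] :
    VecBundle k V (finrank k B) where
  Fiber _ := B
  ι := Basis (Fin (finrank k B)) k B
  base _ := Set.univ
  isOpen_base _ := (zariski k V).isOpen_univ
  cover _ := ⟨finBasis k B, trivial⟩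
  frame c _ a := c a
  indep c _ _ := c.linearIndependent
  span c _ _ := c.span_eq
  transition c c' := ⟨fun b a _ => c'.repr (c a) b, fun _ _ => regular_const _ _,
    fun _ _ a => (c'.sum_repr (c a)).symm⟩

/-- The tensor product `A ⊗ L` of a fixed vector space and a line bundle. -/
def constTensor (A : Type*) [AddCommGroup A] [Module k A] [FiniteDimensional k A]
    (L : VecBundle k V 1) : VecBundle k V (finrank k A) where
  Fiber x := A ⊗[k] L.Fiber x
  ι := Basis (Fin (finrank k A)) k A × L.ι
  base i := L.base i.2
  isOpen_base i := L.isOpen_base i.2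
  cover x := (L.cover x).imp' (fun j => (finBasis k A, j)) fun _ h => h
  frame i x a := i.1 a ⊗ₜ[k] L.frame i.2 x 0
  indep i x hx := by
    have h := ((i.1.tensorProduct (L.basis i.2 x hx)).linearIndependent).comp
      (fun a : Fin (finrank k A) => (a, (0 : Fin 1))) (fun a b h => (Prod.ext_iff.mp h).1)
    have e : (i.1.tensorProduct (L.basis i.2 x hx)) ∘
        (fun a : Fin (finrank k A) => (a, (0 : Fin 1))) =
        fun a => i.1 a ⊗ₜ[k] L.frame i.2 x 0 := by
      funext a
      simp
    rw [e] at h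
    exact h
  span i x hx := by
    have h := (i.1.tensorProduct (L.basis i.2 x hx)).span_eq
    rw [eq_top_iff, ← h]
    refine Submodule.span_mono ?_
    rintro _ ⟨⟨a, c⟩, rfl⟩
    refine ⟨a, ?_⟩
    simp [Subsingleton.elim c 0]
  transition i j := by
    obtain ⟨G, hG, h⟩ := L.transition i.2 j.2
    refine ⟨fun b a x => j.1.repr (i.1 a) b * G 0 0 x, fun b a => ?_, fun x hx a => ?_⟩
    · exact mul_mem (regular_const _ _) (hG 0 0)
    · rw [h x hx 0, Fin.sum_univ_one]
      conv_lhs => rw [← j.1.sum_repr (i.1 a)]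
      rw [TensorProduct.sum_tmul]
      exact Finset.sum_congr rfl fun b _ => TensorProduct.smul_tmul_smul _ _ _ _

/-- The direct sum of finitely many line bundles. -/
def directSum {r : ℕ} (L : Fin r → VecBundle k V 1) : VecBundle k V r where
  Fiber x := ∀ a, (L a).Fiber x
  ι := ∀ a, (L a).ι
  base i := {x | ∀ a, x ∈ (L a).base (i a)}
  isOpen_base i := by
    let _ := zariski k V
    have : {x | ∀ a, x ∈ (L a).base (i a)} = ⋂ a, (L a).base (i a) := by ext; simp
    rw [this]
    exact isOpen_iInter_of_finite fun a => (L a).isOpen_base (i a)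
  cover x := by
    choose i hi using fun a => (L a).cover x
    exact ⟨i, hi⟩
  frame i x a := Pi.single a ((L a).frame (i a) x 0)
  indep i x hx := by
    rw [Fintype.linearIndependent_iff]
    intro g hg a
    have h := congrFun hg a
    rw [Finset.sum_apply, Finset.sum_eq_single a] at h
    · rw [Pi.smul_apply, Pi.single_eq_same] at h
      have h0 := ((L a).indep (i a) x (hx a)).ne_zero 0
      exact (smul_eq_zero.mp h).resolve_right h0
    · intro b _ hb
      rw [Pi.smul_apply, Pi.single_eq_of_ne hb.symm, smul_zero]
    · simp
  span i x hx := by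
    rw [eq_top_iff]
    intro v _
    rw [← Finset.univ_sum_single v]
    refine sum_mem fun a _ => ?_
    have h : v a ∈ Submodule.span k (Set.range ((L a).frame (i a) x)) := by
      rw [(L a).span (i a) x (hx a)]; trivial
    rw [Set.range_unique, Submodule.mem_span_singleton] at h
    obtain ⟨t, ht⟩ := h
    rw [← ht, Pi.single_smul]
    exact Submodule.smul_mem _ _ (Submodule.subset_span ⟨a, rfl⟩)
  transition i j := by
    choose G hG h using fun a => (L a).transition (i a) (j a)
    refine ⟨fun b a x => if b = a then G a 0 0 x else 0, fun b a => ?_, fun x hx a => ?_⟩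
    · by_cases e : b = a
      · simp only [e, if_true]
        exact regular_mono (U := (L a).base (i a) ∩ (L a).base (j a))
          (fun x hx => ⟨hx.1 a, hx.2 a⟩) (hG a 0 0)
      · simp only [e, if_false]
        exact regular_const _ _
    · rw [h a x ⟨hx.1 a, hx.2 a⟩ 0, Fin.sum_univ_one, Pi.single_smul]
      simp [ite_smul]

theorem ιMulti_sum {W : Type*} [AddCommGroup W] [Module k W] {r : ℕ} (c : Basis (Fin r) k W)
    (G : Matrix (Fin r) (Fin r) k) :
    exteriorPower.ιMulti k r (fun a => ∑ b, G b a • c b) =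
      G.det • exteriorPower.ιMulti k r (fun b => c b) := by
  have h : exteriorPower.ιMulti k r =
      (LinearMap.toSpanSingleton k _ (exteriorPower.ιMulti k r (fun b => c b))).compAlternatingMap
        c.det := by
    refine Basis.ext_alternating c fun v hv => ?_
    obtain ⟨σ, rfl⟩ : ∃ σ : Equiv.Perm (Fin r), v = σ :=
      ⟨Equiv.ofBijective v (Finite.injective_iff_bijective.mp hv), rfl⟩
    have h1 := (exteriorPower.ιMulti k r (M := W)).map_perm (fun b => c b) σ
    have h2 := c.det.map_perm (fun b => c b) σ
    simp only [Function.comp_def] at h1 h2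
    rw [h1]
    simp only [LinearMap.compAlternatingMap_apply, h2, LinearMap.toSpanSingleton_apply]
    rw [show c.det (fun b => c b) = 1 from c.det_self]
    rw [smul_assoc, one_smul]
  conv_lhs => rw [h]
  simp only [LinearMap.compAlternatingMap_apply, LinearMap.toSpanSingleton_apply]
  congr 1
  rw [Basis.det_apply]
  congr 1
  ext b a
  simp [Basis.toMatrix_apply, Finsupp.single_apply]

/-- The determinant (top exterior power) of a vector bundle. -/
def detBundle {r : ℕ} (E : VecBundle k V r) : VecBundle k V 1 where
  Fiber x := ⋀[k]^r (E.Fiber x)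
  ι := E.ι
  base := E.base
  isOpen_base := E.isOpen_base
  cover := E.cover
  frame i x _ := exteriorPower.ιMulti k r (E.frame i x)
  indep i x hx := by
    have hfin := E.finite_fiber x
    have hspan : ⊤ ≤ Submodule.span k (Set.range fun _ : Fin 1 =>
        exteriorPower.ιMulti k r (E.frame i x)) := by
      rw [← exteriorPower.ιMulti_span, Submodule.span_le]
      rintro _ ⟨v, rfl⟩
      have h := ιMulti_sum (E.basis i x hx) (Matrix.of fun b a => (E.basis i x hx).repr (v a) b)
      simp only [Matrix.of_apply, (E.basis i x hx).sum_repr] at h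
      simp only [E.basis_apply] at h
      rw [h]
      exact Submodule.smul_mem _ _ (Submodule.subset_span ⟨0, rfl⟩)
    refine linearIndependent_of_top_le_span_of_card_eq_finrank hspan ?_
    rw [exteriorPower.finrank_eq, E.finrank_fiber]
    simp
  span i x hx := by
    rw [eq_top_iff, ← exteriorPower.ιMulti_span, Submodule.span_le]
    rintro _ ⟨v, rfl⟩
    have h := ιMulti_sum (E.basis i x hx) (Matrix.of fun b a => (E.basis i x hx).repr (v a) b)
    simp only [Matrix.of_apply, (E.basis i x hx).sum_repr] at h
    simp only [E.basis_apply] at h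
    rw [h]
    exact Submodule.smul_mem _ _ (Submodule.subset_span ⟨0, rfl⟩)
  transition i j := by
    obtain ⟨G, hG, h⟩ := E.transition i j
    refine ⟨fun _ _ x => (Matrix.of fun b a => G b a x).det, fun _ _ => regular_det hG,
      fun x hx _ => ?_⟩
    rw [Fin.sum_univ_one]
    have h1 := ιMulti_sum (E.basis j x hx.2) (Matrix.of fun b a => G b a x)
    simp only [Matrix.of_apply, E.basis_apply] at h1
    rw [← h1]
    congr 1
    funext a
    exact h x hx a

open Classical in
/-- The first Chern class, as an integer multiple of the class of a hyperplane: it is the integer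
`d` such that `det E` is isomorphic to `𝒪(d)`. On a point (where all the line bundles are
isomorphic) it is `0`. -/
def c₁ {r : ℕ} (E : VecBundle k V r) : ℤ :=
  if h : ∃! d : ℤ, Isomorphic (detBundle E) (twist k V d) then h.choose else 0

/-! #### Restriction to linear subspaces -/

theorem rep_map {W : Submodule k V} (y : ℙ k W) : ∃ t : k, t ≠ 0 ∧
    (Projectivization.map W.subtype W.subtype_injective y).rep = t • (y.rep : V) := by
  have h : Projectivization.map W.subtype W.subtype_injective y =
      Projectivization.mk k (y.rep : V) (by simpa using y.rep_nonzero) := by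
    conv_lhs => rw [← y.mk_rep]
    rw [Projectivization.map_mk]
    rfl
  obtain ⟨t, ht⟩ := Projectivization.exists_smul_eq_mk_rep k (y.rep : V)
    (by simpa using y.rep_nonzero)
  refine ⟨t, t.ne_zero, ?_⟩
  rw [h, ← ht]
  rfl

/-- The restriction of polynomials to a linear subspace. -/
def restrictForm (W : Submodule k V) (p : MvPolynomial (Dual k V) k) :
    MvPolynomial (Dual k W) k :=
  MvPolynomial.rename (fun l : Dual k V => l ∘ₗ W.subtype) p

theorem evalForm_restrictForm (W : Submodule k V) (p : MvPolynomial (Dual k V) k) (w : W) :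
    evalForm (restrictForm W p) w = evalForm p (w : V) := by
  simp [evalForm, restrictForm, MvPolynomial.eval_rename, Function.comp_def]

/-- The inclusion of the projective space of a subspace. -/
def incl (W : Submodule k V) (y : ℙ k W) : ℙ k V :=
  Projectivization.map W.subtype W.subtype_injective y

theorem evalForm_incl (W : Submodule k V) {p : MvPolynomial (Dual k V) k} {d : ℕ}
    (hp : p.IsHomogeneous d) (y : ℙ k W) : ∃ t : k, t ≠ 0 ∧
    (incl W y).rep = t • (y.rep : V) ∧
    evalForm p (incl W y).rep = t ^ d * evalForm (restrictForm W p) y.rep := by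
  obtain ⟨t, ht, h⟩ := rep_map y
  refine ⟨t, ht, h, ?_⟩
  rw [incl, h, evalForm_smul hp, evalForm_restrictForm]

theorem isOpen_preimage_incl (W : Submodule k V) {U : Set (ℙ k V)} (hU : IsOpen[zariski k V] U) :
    IsOpen[zariski k W] (incl W ⁻¹' U) := by
  intro y hy
  obtain ⟨d, q, hq, hqx, h⟩ := hU _ hy
  refine ⟨d, restrictForm W q, hq.rename_isHomogeneous, fun h0 => hqx ?_, fun z hz => h _ ?_⟩
  · obtain ⟨t, _, _, e⟩ := evalForm_incl W hq y
    rw [e, h0, mul_zero]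
  · obtain ⟨t, ht, _, e⟩ := evalForm_incl W hq z
    rw [e]
    exact mul_ne_zero (pow_ne_zero _ ht) hz

theorem regular_comp_incl (W : Submodule k V) {U : Set (ℙ k V)} {g : ℙ k V → k}
    (hg : g ∈ regularFunctions U) : g ∘ incl W ∈ regularFunctions (incl W ⁻¹' U) := by
  intro y hy
  obtain ⟨d, p, q, hp, hq, hqx, h⟩ := hg _ hy
  refine ⟨d, restrictForm W p, restrictForm W q, hp.rename_isHomogeneous,
    hq.rename_isHomogeneous, fun h0 => hqx ?_, fun z hz hne => ?_⟩
  · obtain ⟨t, _, _, e⟩ := evalForm_incl W hq y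
    rw [e, h0, mul_zero]
  · obtain ⟨t, ht, et, e⟩ := evalForm_incl W hq z
    have e' : evalForm p (incl W z).rep = t ^ d * evalForm (restrictForm W p) z.rep := by
      rw [et, evalForm_smul hp, evalForm_restrictForm]
    have ht' := pow_ne_zero d ht
    rw [Function.comp_apply, h _ hz (by rw [e]; exact mul_ne_zero ht' hne), e, e',
      mul_div_mul_left _ _ ht']

/-- The restriction of a vector bundle to the projective space of a linear subspace. -/
def restrict {r : ℕ} (E : VecBundle k V r) (W : Submodule k V) : VecBundle k W r where
  Fiber y := E.Fiber (incl W y)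
  ι := E.ι
  base i := incl W ⁻¹' E.base i
  isOpen_base i := isOpen_preimage_incl W (E.isOpen_base i)
  cover y := E.cover (incl W y)
  frame i y := E.frame i (incl W y)
  indep i y := E.indep i (incl W y)
  span i y := E.span i (incl W y)
  transition i j := by
    obtain ⟨G, hG, h⟩ := E.transition i j
    exact ⟨fun b a => G b a ∘ incl W, fun b a => regular_comp_incl W (hG b a),
      fun y hy a => h _ hy a⟩

/-- `E` is uniform of splitting type `(d₁, …, d_r)`: the restriction of `E` to every line is
isomorphic to the direct sum of the `𝒪(dᵢ)`. The lines of `ℙ k V` are the `ℙ k W`, for `W` a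
subspace of dimension two. -/
def IsUniformOfType {r : ℕ} (E : VecBundle k V r) (d : Fin r → ℤ) : Prop :=
  ∀ W : Submodule k V, finrank k W = 2 →
    Isomorphic (restrict E W) (directSum fun i => twist k W (d i))

/-! #### Image and cokernel of a morphism of constant rank -/

section Constant

variable {e f : ℕ} {E : VecBundle k V e} {F : VecBundle k V f}

/-- The charts used for the image and the cokernel of a morphism: a chart of the source, a chart of
the target, and the (constant) coefficients in these charts of `r` sections of the source and
`f - r` sections of the target. -/
abbrev AdaptedIndex (E : VecBundle k V e) (F : VecBundle k V f) (r : ℕ) :=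
  E.ι × F.ι × (Fin r → Fin e → k) × (Fin (f - r) → Fin f → k)

/-- The images of the `r` chosen sections of the source. -/
def imSec (φ : Hom E F) {r : ℕ} (i : AdaptedIndex E F r) (x : ℙ k V) (a : Fin r) : F.Fiber x :=
  φ.toFun x (∑ m, i.2.2.1 a m • E.frame i.1 x m)

/-- The `f - r` chosen sections of the target. -/
def compSec {r : ℕ} (i : AdaptedIndex E F r) (x : ℙ k V) (a : Fin (f - r)) : F.Fiber x :=
  ∑ m, i.2.2.2 a m • F.frame i.2.1 x m

/-- The two families together. -/
def adSec (φ : Hom E F) {r : ℕ} (i : AdaptedIndex E F r) (x : ℙ k V) :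
    Fin r ⊕ Fin (f - r) → F.Fiber x :=
  Sum.elim (imSec φ i x) (compSec i x)

/-- The open set where the two families together are a basis of the target. -/
def adBase (φ : Hom E F) {r : ℕ} (i : AdaptedIndex E F r) : Set (ℙ k V) :=
  {x | (x ∈ E.base i.1 ∩ F.base i.2.1) ∧ LinearIndependent k (adSec φ i x)}

theorem adSec_regular (φ : Hom E F) {r : ℕ} (i : AdaptedIndex E F r) :
    ∃ G : Fin f → (Fin r ⊕ Fin (f - r)) → ℙ k V → k,
      (∀ b a, G b a ∈ regularFunctions (E.base i.1 ∩ F.base i.2.1)) ∧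
      ∀ x ∈ E.base i.1 ∩ F.base i.2.1, ∀ a,
        adSec φ i x a = ∑ b, G b a x • F.frame i.2.1 x b := by
  obtain ⟨G, hG, h⟩ := φ.regular i.1 i.2.1
  refine ⟨fun b => Sum.elim (fun a x => ∑ m, i.2.2.1 a m * G b m x) (fun a _ => i.2.2.2 a b),
    fun b a => ?_, fun x hx a => ?_⟩
  · rcases a with a | a
    · exact regular_sum_mul (fun m => regular_const _ _) (fun m => hG b m)
    · exact regular_const _ _
  · rcases a with a | a
    · simp only [adSec, imSec, Sum.elim_inl, map_sum, map_smul, h x hx, Finset.smul_sum,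
        Finset.sum_smul, smul_smul]
      rw [Finset.sum_comm]
    · rfl

theorem rank_le (φ : Hom E F) {r : ℕ} (x : ℙ k V)
    (hφ : finrank k (LinearMap.range (φ.toFun x)) = r) : r ≤ f := by
  have := F.finite_fiber x
  have h := Submodule.finrank_le (LinearMap.range (φ.toFun x))
  rwa [hφ, F.finrank_fiber x] at h

theorem frame_change {κ : Type*} [Fintype κ] [DecidableEq κ] (ε : κ ≃ Fin f) (j : F.ι)
    {U : Set (ℙ k V)} (hU : IsOpen[zariski k V] U) (hUj : U ⊆ F.base j)
    (σ : ∀ x, κ → F.Fiber x) (G : Fin f → κ → ℙ k V → k)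
    (hG : ∀ b a, G b a ∈ regularFunctions U)
    (h : ∀ x ∈ U, ∀ a, σ x a = ∑ b, G b a x • F.frame j x b) :
    IsOpen[zariski k V] {x | x ∈ U ∧ LinearIndependent k (σ x)} ∧
    ∃ H : κ → Fin f → ℙ k V → k,
      (∀ a b, H a b ∈ regularFunctions {x | x ∈ U ∧ LinearIndependent k (σ x)}) ∧
      ∀ x ∈ {x | x ∈ U ∧ LinearIndependent k (σ x)}, ∀ b,
        F.frame j x b = ∑ a, H a b x • σ x a := by
  set N : ℙ k V → Matrix (Fin f) (Fin f) k := fun x => Matrix.of fun b a => G b (ε.symm a) x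
    with hN
  have hdetU : (fun x => (N x).det) ∈ regularFunctions U := regular_det fun b a => hG b _
  have hiff : ∀ x ∈ U, (LinearIndependent k (σ x) ↔ (N x).det ≠ 0) := by
    intro x hx
    have hfin := F.finite_fiber x
    have e1 : N x = (F.basis j x (hUj hx)).toMatrix (σ x ∘ ε.symm) := by
      ext b a
      rw [Basis.toMatrix_apply, Function.comp_apply, h x hx]
      simp only [hN, Matrix.of_apply, ← F.basis_apply j x (hUj hx), map_sum, map_smul,
        Basis.repr_self, Finsupp.coe_finsetSum, Finsupp.coe_smul, Finset.sum_apply,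
        Pi.smul_apply, Finsupp.single_apply, smul_eq_mul, mul_ite, mul_one, mul_zero,
        Finset.sum_ite_eq', Finset.mem_univ, if_true]
    rw [e1, ← Basis.det_apply, ← isUnit_iff_ne_zero, ← Basis.is_basis_iff_det,
      ← linearIndependent_equiv ε.symm]
    refine ⟨fun hl => ⟨hl, ?_⟩, fun hl => hl.1⟩
    exact hl.span_eq_top_of_card_eq_finrank' (by simp [F.finrank_fiber])
  have hset : {x | x ∈ U ∧ LinearIndependent k (σ x)} = {x | x ∈ U ∧ (N x).det ≠ 0} := by
    ext x
    exact and_congr_right fun hx => hiff x hx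
  have hsub : {x | x ∈ U ∧ (N x).det ≠ 0} ⊆ U := fun x hx => hx.1
  rw [hset]
  refine ⟨isOpen_regular_ne_zero hU hdetU, fun a b x => ((N x).det)⁻¹ * (N x).adjugate (ε a) b,
    fun a b => ?_, fun x hx b => ?_⟩
  · refine mul_mem (regular_inv (regular_mono hsub hdetU) fun x hx => hx.2) ?_
    have : (fun x => (N x).adjugate (ε a) b) = fun x =>
        (Matrix.of fun c d => ((if c = b then fun _ => if d = ε a then (1 : k) else 0
          else G c (ε.symm d)) : ℙ k V → k) x).det := by
      funext x
      rw [Matrix.adjugate_apply]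
      congr 1
      ext c d
      by_cases hc : c = b
      · subst hc; simp [Pi.single_apply]
      · simp [hc, hN]
    rw [this]
    refine regular_det fun c d => ?_
    split_ifs
    · exact regular_const _ _
    · exact regular_const _ _
    · exact regular_mono hsub (hG _ _)
  · have h1 : N x * ((N x).det⁻¹ • (N x).adjugate) = 1 := by
      rw [Matrix.mul_smul, Matrix.mul_adjugate, smul_smul, inv_mul_cancel₀ hx.2, one_smul]
    have h2 : ∀ c, ∑ a, G c a x * ((N x).det⁻¹ * (N x).adjugate (ε a) b) =
        if c = b then 1 else 0 := by
      intro c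
      have h3 := congrFun (congrFun h1 c) b
      rw [Matrix.mul_apply, Matrix.one_apply] at h3
      rw [← h3, ← ε.sum_comp]
      simp [hN]
    simp only [h x hx.1, Finset.smul_sum, smul_smul]
    rw [Finset.sum_comm]
    simp only [← Finset.sum_smul]
    have h4 : ∀ c, (∑ a, ((N x).det)⁻¹ * (N x).adjugate (ε a) b * G c a x) =
        if c = b then 1 else 0 := by
      intro c
      rw [← h2 c]
      exact Finset.sum_congr rfl fun a _ => mul_comm _ _
    simp [h4]

theorem adBase_isOpen (φ : Hom E F) {r : ℕ}
    (hφ : ∀ x, finrank k (LinearMap.range (φ.toFun x)) = r) (i : AdaptedIndex E F r) :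
    IsOpen[zariski k V] (adBase φ i) := by
  by_cases hr : r ≤ f
  · obtain ⟨G, hG, h⟩ := adSec_regular φ i
    have ε : Fin r ⊕ Fin (f - r) ≃ Fin f := finSumFinEquiv.trans (finCongr (by omega))
    exact (frame_change ε i.2.1 ((zariski k V).isOpen_inter _ _ (E.isOpen_base _)
      (F.isOpen_base _)) Set.inter_subset_right _ G hG h).1
  · exact fun x _ => absurd (rank_le φ x (hφ x)) hr

theorem adSec_transition (φ : Hom E F) {r : ℕ}
    (hφ : ∀ x, finrank k (LinearMap.range (φ.toFun x)) = r) (i j : AdaptedIndex E F r) :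
    ∃ K : (Fin r ⊕ Fin (f - r)) → (Fin r ⊕ Fin (f - r)) → ℙ k V → k,
      (∀ b a, K b a ∈ regularFunctions (adBase φ i ∩ adBase φ j)) ∧
      ∀ x ∈ adBase φ i ∩ adBase φ j, ∀ a, adSec φ i x a = ∑ b, K b a x • adSec φ j x b := by
  by_cases hr : r ≤ f
  · obtain ⟨G, hG, h⟩ := adSec_regular φ i
    obtain ⟨G', hG', h'⟩ := adSec_regular φ j
    have ε : Fin r ⊕ Fin (f - r) ≃ Fin f := finSumFinEquiv.trans (finCongr (by omega))
    obtain ⟨H, hH, hh⟩ := (frame_change ε j.2.1 ((zariski k V).isOpen_inter _ _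
      (E.isOpen_base _) (F.isOpen_base _)) Set.inter_subset_right _ G' hG' h').2
    obtain ⟨T, hT, ht⟩ := F.transition i.2.1 j.2.1
    refine ⟨fun b a x => ∑ c, (∑ d, H b d x * T d c x) * G c a x, fun b a => ?_,
      fun x hx a => ?_⟩
    · refine regular_sum_mul (fun c => regular_sum_mul (fun d => ?_) (fun d => ?_)) (fun c => ?_)
      · exact regular_mono (fun x hx => hx.2) (hH b d)
      · exact regular_mono (U := F.base i.2.1 ∩ F.base j.2.1)
          (fun x hx => ⟨hx.1.1.2, hx.2.1.2⟩) (hT d c)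
      · exact regular_mono (fun x hx => hx.1.1) (hG c a)
    · rw [h x hx.1.1 a]
      have e1 : ∀ c, F.frame i.2.1 x c = ∑ b, (∑ d, H b d x * T d c x) • adSec φ j x b := by
        intro c
        rw [ht x ⟨hx.1.1.2, hx.2.1.2⟩ c]
        simp only [hh x hx.2, Finset.smul_sum, smul_smul, Finset.sum_smul]
        rw [Finset.sum_comm]
        simp only [mul_comm]
      simp only [e1, Finset.smul_sum, smul_smul, Finset.sum_smul]
      rw [Finset.sum_comm]
      refine Finset.sum_congr rfl fun b _ => Finset.sum_congr rfl fun c _ => ?_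
      rw [← Finset.sum_smul, Finset.sum_mul]
      congr 1
      exact Finset.sum_congr rfl fun d _ => by ring
  · exact ⟨0, fun b a x _ => absurd (rank_le φ x (hφ x)) hr,
      fun x _ => absurd (rank_le φ x (hφ x)) hr⟩

theorem adBase_cover (φ : Hom E F) {r : ℕ}
    (hφ : ∀ x, finrank k (LinearMap.range (φ.toFun x)) = r) (x : ℙ k V) :
    ∃ i : AdaptedIndex E F r, x ∈ adBase φ i := by
  obtain ⟨i, hi⟩ := E.cover x
  obtain ⟨j, hj⟩ := F.cover x
  have hE := E.finite_fiber x
  have hF := F.finite_fiber x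
  obtain ⟨Q, hQ⟩ := Submodule.exists_isCompl (LinearMap.range (φ.toFun x))
  have hQr : finrank k Q = f - r := by
    have := Submodule.finrank_add_eq_of_isCompl hQ
    rw [hφ x, F.finrank_fiber x] at this
    omega
  let s := finBasisOfFinrankEq k _ (hφ x)
  let t := finBasisOfFinrankEq k Q hQr
  choose w hw using fun a => (s a).2
  refine ⟨⟨i, j, fun a m => (E.basis i x hi).repr (w a) m,
    fun a m => (F.basis j x hj).repr (t a) m⟩, ⟨hi, hj⟩, ?_⟩
  have e1 : ∀ a, ∑ m, (E.basis i x hi).repr (w a) m • E.frame i x m = w a := by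
    intro a
    simpa using (E.basis i x hi).sum_repr (w a)
  have e2 : ∀ a, ∑ m, (F.basis j x hj).repr (t a : F.Fiber x) m • F.frame j x m = t a := by
    intro a
    simpa using (F.basis j x hj).sum_repr (t a : F.Fiber x)
  unfold adSec
  refine LinearIndependent.sum_type ?_ ?_ ?_
  · convert s.linearIndependent.map' (Submodule.subtype _) (Submodule.ker_subtype _) using 1
    funext a
    simp only [imSec, e1, hw]
    rfl
  · convert t.linearIndependent.map' (Submodule.subtype _) (Submodule.ker_subtype _) using 1
    funext a
    simp only [compSec, e2]
    rfl
  · refine hQ.disjoint.mono ?_ ?_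
    · rw [Submodule.span_le]
      rintro _ ⟨a, rfl⟩
      exact LinearMap.mem_range_self _ _
    · rw [Submodule.span_le]
      rintro _ ⟨a, rfl⟩
      simp only [compSec, e2]
      exact (t a).2

/-- `imSec` as a family of vectors of the image. -/
def imFrame (φ : Hom E F) {r : ℕ} (i : AdaptedIndex E F r) (x : ℙ k V) (a : Fin r) :
    LinearMap.range (φ.toFun x) :=
  ⟨imSec φ i x a, LinearMap.mem_range_self _ _⟩

theorem imFrame_indep (φ : Hom E F) {r : ℕ} (i : AdaptedIndex E F r) {x : ℙ k V}
    (hx : x ∈ adBase φ i) : LinearIndependent k (imFrame φ i x) := by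
  have h := hx.2.comp Sum.inl Sum.inl_injective
  exact LinearIndependent.of_comp (Submodule.subtype _) h

theorem imFrame_span (φ : Hom E F) {r : ℕ}
    (hφ : ∀ x, finrank k (LinearMap.range (φ.toFun x)) = r) (i : AdaptedIndex E F r) {x : ℙ k V}
    (hx : x ∈ adBase φ i) : Submodule.span k (Set.range (imFrame φ i x)) = ⊤ := by
  have hF := F.finite_fiber x
  exact (imFrame_indep φ i hx).span_eq_top_of_card_eq_finrank' (by simp [hφ x])

theorem adSec_span (φ : Hom E F) {r : ℕ}
    (hφ : ∀ x, finrank k (LinearMap.range (φ.toFun x)) = r) (i : AdaptedIndex E F r) {x : ℙ k V}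
    (hx : x ∈ adBase φ i) : Submodule.span k (Set.range (adSec φ i x)) = ⊤ := by
  have hF := F.finite_fiber x
  have := rank_le φ x (hφ x)
  refine hx.2.span_eq_top_of_card_eq_finrank' ?_
  rw [F.finrank_fiber, Fintype.card_sum, Fintype.card_fin, Fintype.card_fin]
  omega

/-- The image of a morphism of constant rank `r`: the fibre at `x` is the image of the map between
the fibres at `x`. -/
def imageBundle (φ : Hom E F) {r : ℕ} (hφ : ∀ x, finrank k (LinearMap.range (φ.toFun x)) = r) :
    VecBundle k V r where
  Fiber x := LinearMap.range (φ.toFun x)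
  ι := AdaptedIndex E F r
  base := adBase φ
  isOpen_base := adBase_isOpen φ hφ
  cover := adBase_cover φ hφ
  frame := imFrame φ
  indep i _ hx := imFrame_indep φ i hx
  span i _ hx := imFrame_span φ hφ i hx
  transition i j := by
    obtain ⟨K, hK, h⟩ := adSec_transition φ hφ i j
    refine ⟨fun b a => K (.inl b) (.inl a), fun b a => hK _ _, fun x hx a => ?_⟩
    have h1 : imFrame φ i x a ∈ Submodule.span k (Set.range (imFrame φ j x)) := by
      rw [imFrame_span φ hφ j hx.2]; trivial
    obtain ⟨c, hc⟩ := (Submodule.mem_span_range_iff_exists_fun k).mp h1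
    have h2 := h x hx (.inl a)
    have h3 : adSec φ i x (.inl a) = ∑ b, (Sum.elim c 0 : _ → k) b • adSec φ j x b := by
      rw [Fintype.sum_sum_type]
      have := congrArg (Subtype.val) hc
      simp only [AddSubmonoidClass.coe_finsetSum, SetLike.val_smul] at this
      simp only [Sum.elim_inl, Sum.elim_inr, Pi.zero_apply, zero_smul, Finset.sum_const_zero,
        add_zero]
      exact this.symm
    have h4 := hx.2.2.eq_coords_of_eq (h2.symm.trans h3)
    rw [← hc]
    refine Finset.sum_congr rfl fun b _ => ?_
    have := h4 (.inl b)
    simp only [Sum.elim_inl] at this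
    exact congrArg (· • imFrame φ j x b) this.symm

/-- The classes of the complementary sections modulo the image. -/
def cokerFrame (φ : Hom E F) {r : ℕ} (i : AdaptedIndex E F r) (x : ℙ k V) (a : Fin (f - r)) :
    F.Fiber x ⧸ LinearMap.range (φ.toFun x) :=
  (LinearMap.range (φ.toFun x)).mkQ (compSec i x a)

theorem mkQ_adSec_inl (φ : Hom E F) {r : ℕ} (i : AdaptedIndex E F r) (x : ℙ k V) (a : Fin r) :
    (LinearMap.range (φ.toFun x)).mkQ (adSec φ i x (.inl a)) = 0 :=
  (Submodule.Quotient.mk_eq_zero _).mpr (LinearMap.mem_range_self _ _)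

theorem cokerFrame_span (φ : Hom E F) {r : ℕ}
    (hφ : ∀ x, finrank k (LinearMap.range (φ.toFun x)) = r) (i : AdaptedIndex E F r) {x : ℙ k V}
    (hx : x ∈ adBase φ i) : Submodule.span k (Set.range (cokerFrame φ i x)) = ⊤ := by
  have e : Submodule.map (LinearMap.range (φ.toFun x)).mkQ
      (Submodule.span k (Set.range (adSec φ i x))) = ⊤ := by
    rw [adSec_span φ hφ i hx, Submodule.map_top, Submodule.range_mkQ]
  rw [eq_top_iff, ← e, Submodule.map_span, Submodule.span_le]
  rintro _ ⟨_, ⟨a, rfl⟩, rfl⟩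
  rcases a with a | a
  · rw [mkQ_adSec_inl]
    exact Submodule.zero_mem _
  · exact Submodule.subset_span ⟨a, rfl⟩

/-- The cokernel of a morphism of constant rank `r`: the fibre at `x` is the cokernel of the map
between the fibres at `x`. -/
def cokerBundle (φ : Hom E F) {r : ℕ} (hφ : ∀ x, finrank k (LinearMap.range (φ.toFun x)) = r) :
    VecBundle k V (f - r) where
  Fiber x := F.Fiber x ⧸ LinearMap.range (φ.toFun x)
  ι := AdaptedIndex E F r
  base := adBase φ
  isOpen_base := adBase_isOpen φ hφ
  cover := adBase_cover φ hφ
  frame := cokerFrame φ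
  indep i x hx := by
    have hF := F.finite_fiber x
    refine linearIndependent_of_top_le_span_of_card_eq_finrank (cokerFrame_span φ hφ i hx).ge ?_
    have := Submodule.finrank_quotient_add_finrank (LinearMap.range (φ.toFun x))
    rw [hφ x, F.finrank_fiber] at this
    rw [Fintype.card_fin]
    omega
  span i _ hx := cokerFrame_span φ hφ i hx
  transition i j := by
    obtain ⟨K, hK, h⟩ := adSec_transition φ hφ i j
    refine ⟨fun b a => K (.inr b) (.inr a), fun b a => hK _ _, fun x hx a => ?_⟩
    have h2 := congrArg (LinearMap.range (φ.toFun x)).mkQ (h x hx (.inr a))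
    rw [Fintype.sum_sum_type, map_add, map_sum, map_sum] at h2
    simp only [map_smul, mkQ_adSec_inl, smul_zero, Finset.sum_const_zero, zero_add] at h2
    exact h2

end Constant

end Bundles

/-! ### The bundles of a space of matrices of constant rank -/

section MatrixSpaces

variable {k : Type*} [Field k]
  {A : Type*} [AddCommGroup A] [Module k A] [FiniteDimensional k A]
  {B : Type*} [AddCommGroup B] [Module k B] [FiniteDimensional k B]

/-- The space `M` of linear maps from `A` to `B` has constant rank `r`. -/
def HasConstantRank (M : Submodule k (A →ₗ[k] B)) (r : ℕ) : Prop :=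
  ∀ f ∈ M, f ≠ 0 → finrank k (LinearMap.range f) = r

/-- The map `A ⊗ 𝒪(-1) → B` over the point `x = ⟨f⟩` of `ℙ k M`. An element `h` of the fibre of
`𝒪(-1)` is the vector `h(f) f` of the line `x`, and `v ⊗ h` is sent to `h(f) f(v)`. -/
def psiFun (M : Submodule k (A →ₗ[k] B)) (x : ℙ k M) :
    A ⊗[k] twistFiber (k := k) (V := M) (-1) x →ₗ[k] B :=
  TensorProduct.lift (LinearMap.mk₂ k
    (fun (v : A) (h : twistFiber (k := k) (V := M) (-1) x) =>
      h.1 (repMem x) • (x.rep : A →ₗ[k] B) v)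
    (fun v v' h => by simp) (fun c v h => by rw [map_smul, smul_comm])
    (fun v h h' => by simp [add_smul]) (fun c v h => by simp [mul_smul]))

theorem psiFun_tmul (M : Submodule k (A →ₗ[k] B)) (x : ℙ k M) (v : A)
    (h : twistFiber (k := k) (V := M) (-1) x) :
    psiFun M x (v ⊗ₜ h) = h.1 (repMem x) • (x.rep : A →ₗ[k] B) v := rfl

/-- The description of the map does not depend on the chosen nonzero element of the line `x`. -/
theorem psiFun_tmul' (M : Submodule k (A →ₗ[k] B)) (x : ℙ k M) (v : A)
    (h : twistFiber (k := k) (V := M) (-1) x)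
    (f : {f : M // f ≠ 0 ∧ f ∈ x.submodule}) :
    psiFun M x (v ⊗ₜ h) = h.1 f • (f.1 : A →ₗ[k] B) v := by
  obtain ⟨t, ht, e⟩ := exists_smul_rep f
  rw [psiFun_tmul, h.2 (repMem x) f t e, e]
  simp only [Submodule.coe_smul, LinearMap.smul_apply, smul_smul]
  congr 1
  rw [zpow_neg_one]
  field_simp

/-- The morphism `ψ_M : A ⊗ 𝒪(-1) → B ⊗ 𝒪` of vector bundles on `ℙ k M`. -/
def psi (M : Submodule k (A →ₗ[k] B)) :
    Hom (constTensor A (twist k M (-1))) (trivialBundle k M B) where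
  toFun x := psiFun M x
  regular i c := by
    obtain ⟨i, l⟩ := i
    change Dual k M at l
    change Basis (Fin (finrank k B)) k B at c
    let L : Fin (finrank k B) → Fin (finrank k A) → Dual k M := fun b a =>
      c.coord b ∘ₗ LinearMap.applyₗ (i a) ∘ₗ M.subtype
    refine ⟨fun b a x => L b a x.rep / l x.rep, fun b a => ?_, fun x hx a => ?_⟩
    · exact regular_ratio _ _ _ fun x (hx : _ ∧ _) => hx.1
    · change psiFun M x (i a ⊗ₜ twistFrame (-1) l x) =
        ∑ b, (L b a x.rep / l x.rep) • c b
      rw [psiFun_tmul]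
      change (l x.rep) ^ (-1 : ℤ) • (x.rep : A →ₗ[k] B) (i a) = _
      conv_lhs => rw [← c.sum_repr ((x.rep : A →ₗ[k] B) (i a))]
      rw [Finset.smul_sum]
      refine Finset.sum_congr rfl fun b _ => ?_
      rw [smul_smul, zpow_neg_one, div_eq_inv_mul]
      rfl

theorem range_psi (M : Submodule k (A →ₗ[k] B)) (x : ℙ k M) :
    LinearMap.range ((psi M).toFun x) = LinearMap.range (x.rep : A →ₗ[k] B) := by
  change LinearMap.range (psiFun M x) = _
  apply le_antisymm
  · rintro _ ⟨z, rfl⟩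
    induction z using TensorProduct.induction_on with
    | zero => simp
    | tmul v h => exact Submodule.smul_mem _ _ (LinearMap.mem_range_self _ _)
    | add z z' hz hz' => rw [map_add]; exact add_mem hz hz'
  · rintro _ ⟨v, rfl⟩
    obtain ⟨l, hl⟩ := exists_dual_rep x
    refine ⟨v ⊗ₜ (l x.rep • twistFrame (-1) l x), ?_⟩
    rw [psiFun_tmul]
    change (l x.rep * (l x.rep) ^ (-1 : ℤ)) • _ = _
    rw [zpow_neg_one, mul_inv_cancel₀ hl, one_smul]

theorem HasConstantRank.finrank_range_psi {M : Submodule k (A →ₗ[k] B)} {r : ℕ}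
    (h : HasConstantRank M r) (x : ℙ k M) :
    finrank k (LinearMap.range ((psi M).toFun x)) = r := by
  rw [range_psi]
  exact h _ x.rep.2 (by simpa using x.rep_nonzero)

/-- The image bundle `ℰ_M = Im ψ_M`, of rank `r`. -/
def imBundle (M : Submodule k (A →ₗ[k] B)) {r : ℕ} (h : HasConstantRank M r) :
    VecBundle k M r :=
  imageBundle (psi M) h.finrank_range_psi

/-- The cokernel bundle `E_M = Coker ψ_M`, of rank `dim B - r`. -/
def cokBundle (M : Submodule k (A →ₗ[k] B)) {r : ℕ} (h : HasConstantRank M r) :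
    VecBundle k M (finrank k B - r) :=
  cokerBundle (psi M) h.finrank_range_psi

end MatrixSpaces

end ProjSpace

end

/-! Fix a volume form `D` on `B` and put `m = dim B - r`. For `v` in `M`, vectors `a₁, …, a_r` of
`A` and `b₁, …, b_m` of `B`, the determinant `D(v a₁, …, v a_r, b₁, …, b_m)` is a form of degree `r`
in `v`. Since the image of `v ≠ 0` has dimension `r`, two choices of the `aᵢ` give proportional
functions of `b`: the matrix of these forms, indexed by `a` and `b`, has rank one. Polynomials form
a unique factorization domain and factors of forms are forms, so the entries are products `w(a) ·
U(b)` with `U(b)` of one degree `c ≤ r` (`exists_rank_one_factor`, `exists_cokernelForm`). At every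
`v ≠ 0` some determinant is nonzero, so `U` is there a nonzero alternating `m`-form on the cokernel
of `v`. Hence `U` is an isomorphism `det E_M ≅ 𝒪(c)`.

For `n ≥ 1` no other `𝒪(d)` is possible: the quotient of two such isomorphisms is a nowhere
vanishing function on `M ∖ {0}`, homogeneous of degree `d - c` and locally a quotient of forms. On
an affine line it is a nowhere vanishing regular function, hence constant, and comparing two affine
lines gives `d = c` (`degree_eq_zero_of_ne_zero`, `twist_degree_eq`). So `c₁ = c` lies between `0`
and `r`. For `n = 0` the degree is not unique, `c₁` is `0` by convention, and there are no lines.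

On a line, that is for a pencil `W`, let `S` be the intersection of the images of the nonzero
members. The heart of the matter is that modulo `S` all nonzero members of `W` have the same kernel
(`ker_mkQ_comp_le`). By constant rank, a vector `a` with `f a = 0` modulo `S` extends to a series `∑
cᵢ tⁱ` killed by `f + t g` modulo `S` (`exists_formal_kernel`); the recursion `f cᵢ₊₁ = -g cᵢ` then
puts every `g cᵢ` in the image of every member of the pencil, so in `S`. If `C` is a complement of
the common kernel, the image of `f` is `f(C) ⊕ S` for every `f ≠ 0` in `W`. This splits the image
bundle as `dim C` copies of `𝒪(-1)` and `dim S` copies of `𝒪` (`exists_pencil_frame`,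
`restrict_imageBundle_isomorphic`).

Finally `dim C = c`: inserting this frame of the image in `D` gives forms of degree `dim C`,
proportional to the `U(b)` restricted to `W`, and both families have no common zero, so their
degrees agree (`line_degree_eq`). -/

noncomputable section

namespace ProjSpace

/-! ### Homogeneous factors of a homogeneous polynomial -/

section Factor

variable {k : Type*} [Field k] {σ : Type*}

/-- The substitution `X i ↦ X i * T`, with values in the polynomials in `T`. -/
def scaleVars (k : Type*) [Field k] (σ : Type*) :
    MvPolynomial σ k →ₐ[k] Polynomial (MvPolynomial σ k) :=
  MvPolynomial.aeval fun i => Polynomial.C (MvPolynomial.X i) * Polynomial.X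

theorem scaleVars_of_isHomogeneous {p : MvPolynomial σ k} {d : ℕ} (hp : p.IsHomogeneous d) :
    scaleVars k σ p = Polynomial.C p * Polynomial.X ^ d := by
  conv_rhs => rw [p.as_sum]
  rw [scaleVars, MvPolynomial.aeval_def, MvPolynomial.eval₂_eq, map_sum, Finset.sum_mul]
  refine Finset.sum_congr rfl fun m hm => ?_
  have h := hp (MvPolynomial.mem_support_iff.mp hm)
  have h' : ∑ i ∈ m.support, m i = d := by
    rw [← h, Finsupp.weight_apply, Finsupp.sum]; simp
  simp only [mul_pow, Finset.prod_mul_distrib, Finset.prod_pow_eq_pow_sum, h']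
  rw [← mul_assoc]
  congr 1
  rw [MvPolynomial.monomial_eq, Finsupp.prod, map_mul, map_prod]
  simp only [map_pow]
  rfl

theorem coeff_scaleVars (p : MvPolynomial σ k) (i : ℕ) :
    (scaleVars k σ p).coeff i = MvPolynomial.homogeneousComponent i p := by
  conv_lhs => rw [← MvPolynomial.sum_homogeneousComponent p]
  rw [map_sum, Polynomial.finsetSum_coeff]
  simp only [scaleVars_of_isHomogeneous (MvPolynomial.homogeneousComponent_isHomogeneous _ p),
    Polynomial.coeff_C_mul, Polynomial.coeff_X_pow, mul_ite, mul_one, mul_zero]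
  rw [Finset.sum_ite_eq]
  split_ifs with h
  · rfl
  · rw [MvPolynomial.homogeneousComponent_eq_zero]
    simpa using h

/-- The coefficients in `T` of the scaled polynomial are the homogeneous components of `p`; when the
degree and the trailing degree in `T` agree, only one of them can be nonzero. -/
theorem isHomogeneous_of_natDegree_le {p : MvPolynomial σ k}
    (h : (scaleVars k σ p).natDegree ≤ (scaleVars k σ p).natTrailingDegree) :
    p.IsHomogeneous (scaleVars k σ p).natDegree := by
  have h0 : ∀ i, i ≠ (scaleVars k σ p).natDegree →
      MvPolynomial.homogeneousComponent i p = 0 := by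
    intro i hi
    rw [← coeff_scaleVars]
    rcases lt_or_gt_of_ne hi with h1 | h1
    · exact Polynomial.coeff_eq_zero_of_lt_natTrailingDegree (h1.trans_le h)
    · exact Polynomial.coeff_eq_zero_of_natDegree_lt h1
  rw [← MvPolynomial.sum_homogeneousComponent p]
  refine MvPolynomial.IsHomogeneous.sum _ _ _ fun i _ => ?_
  rw [MvPolynomial.sum_homogeneousComponent p]
  by_cases hi : i = (scaleVars k σ p).natDegree
  · rw [← hi]; exact MvPolynomial.homogeneousComponent_isHomogeneous _ p
  · rw [h0 i hi]; exact MvPolynomial.isHomogeneous_zero _ _ _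

/-- Over a domain the degree and the trailing degree in `T` are both additive. They coincide for the
product, and trailing degree is at most degree, so they coincide for each factor. -/
theorem exists_isHomogeneous_of_mul {p q : MvPolynomial σ k} {n : ℕ}
    (h : (p * q).IsHomogeneous n) (h0 : p * q ≠ 0) :
    ∃ a b, p.IsHomogeneous a ∧ q.IsHomogeneous b ∧ a + b = n := by
  have e := scaleVars_of_isHomogeneous h
  have hC : (Polynomial.C (p * q) : Polynomial (MvPolynomial σ k)) ≠ 0 :=
    Polynomial.C_ne_zero.mpr h0
  have e1 : (scaleVars k σ (p * q)).natDegree = n := by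
    rw [e, Polynomial.natDegree_C_mul_X_pow _ _ h0]
  have e2 : (scaleVars k σ (p * q)).natTrailingDegree = n := by
    rw [e, Polynomial.natTrailingDegree_mul_X_pow hC, Polynomial.natTrailingDegree_C,
      zero_add]
  have hne : scaleVars k σ p * scaleVars k σ q ≠ 0 := by
    rw [← map_mul, e]; exact mul_ne_zero hC (pow_ne_zero _ Polynomial.X_ne_zero)
  have hp := left_ne_zero_of_mul hne
  have hq := right_ne_zero_of_mul hne
  rw [map_mul, Polynomial.natDegree_mul hp hq] at e1
  rw [map_mul, Polynomial.natTrailingDegree_mul hp hq] at e2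
  have h1 := Polynomial.natTrailingDegree_le_natDegree (scaleVars k σ p)
  have h2 := Polynomial.natTrailingDegree_le_natDegree (scaleVars k σ q)
  exact ⟨_, _, isHomogeneous_of_natDegree_le (by omega), isHomogeneous_of_natDegree_le (by omega),
    e1⟩

/-- Divide a nonzero row by its gcd to get coprime entries `u j`. Every other row is proportional to
`u` over the fraction field, and coprimality makes the proportionality factor a polynomial. The
degree of `u j` does not depend on `j`, since the gcd of the row has one fixed degree. -/
theorem exists_rank_one_factor {ι κ : Type*} [Fintype κ] (Q : ι → κ → MvPolynomial σ k) {r : ℕ}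
    (hQ : ∀ i j, (Q i j).IsHomogeneous r)
    (h1 : ∀ i j i' j', Q i j * Q i' j' = Q i j' * Q i' j) {i₀ : ι} {j₀ : κ} (h0 : Q i₀ j₀ ≠ 0) :
    ∃ c ≤ r, ∃ (w : ι → MvPolynomial σ k) (u : κ → MvPolynomial σ k),
      (∀ j, (u j).IsHomogeneous c) ∧ ∀ i j, Q i j = w i * u j := by
  classical
  let _ : StrongNormalizationMonoid (MvPolynomial σ k) :=
    UniqueFactorizationMonoid.strongNormalizationMonoid
  let _ : StrongNormalizedGCDMonoid (MvPolynomial σ k) :=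
    UniqueFactorizationMonoid.toStrongNormalizedGCDMonoid _
  obtain ⟨u, hu, hgcd⟩ := Finset.extract_gcd (s := Finset.univ) (Q i₀) ⟨j₀, Finset.mem_univ _⟩
  set g := Finset.univ.gcd (Q i₀) with hg
  have hu' : ∀ j, Q i₀ j = g * u j := fun j => hu j (Finset.mem_univ j)
  have h0' : g * u j₀ ≠ 0 := hu' j₀ ▸ h0
  have hg0 := left_ne_zero_of_mul h0'
  have huj := right_ne_zero_of_mul h0'
  have h2 : ∀ i j, Q i j * u j₀ = Q i j₀ * u j := by
    intro i j
    have := h1 i j i₀ j₀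
    rw [hu', hu'] at this
    refine mul_left_cancel₀ hg0 ?_
    linear_combination this
  have hdvd : ∀ i, u j₀ ∣ Q i j₀ := by
    intro i
    -- `u j₀` divides `Q i j₀ * u j` for every `j`, hence their gcd, which is `Q i j₀` up to a unit
    -- because the `u j` are coprime.
    have h3 : u j₀ ∣ Finset.univ.gcd fun j => Q i j₀ * u j :=
      Finset.dvd_gcd fun j _ => ⟨Q i j, by rw [← h2]; ring⟩
    rw [Finset.gcd_mul_left, hgcd, mul_one] at h3
    exact h3.trans (normalize_associated _).dvd
  choose w hw using hdvd
  have h4 : ∀ i j, Q i j = w i * u j := by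
    intro i j
    refine mul_left_cancel₀ huj ?_
    have := h2 i j
    rw [hw] at this
    linear_combination this
  obtain ⟨a, c, ha, hc, hac⟩ := exists_isHomogeneous_of_mul (hu' j₀ ▸ hQ i₀ j₀) h0'
  refine ⟨c, by omega, w, u, fun j => ?_, h4⟩
  by_cases hj : u j = 0
  · rw [hj]; exact MvPolynomial.isHomogeneous_zero _ _ _
  · obtain ⟨a', c', ha', hc', hac'⟩ :=
      exists_isHomogeneous_of_mul (hu' j ▸ hQ i₀ j) (mul_ne_zero hg0 hj)
    have := ha.inj_right ha' hg0
    rwa [show c = c' by omega]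

end Factor

/-! ### Homogeneous polynomial functions -/

section Forms

variable {k : Type*} [Field k] {V : Type*} [AddCommGroup V] [Module k V]

/-- `F` is given by a homogeneous polynomial of degree `d`. -/
def IsForm (d : ℕ) (F : V → k) : Prop :=
  ∃ p : MvPolynomial (Dual k V) k, p.IsHomogeneous d ∧ ∀ v, F v = evalForm p v

theorem IsForm.smul {d : ℕ} {F : V → k} (hF : IsForm d F) (t : k) (v : V) :
    F (t • v) = t ^ d * F v := by
  obtain ⟨p, hp, h⟩ := hF
  rw [h, h, evalForm_smul hp]

theorem isForm_const (c : k) : IsForm 0 (fun _ : V => c) :=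
  ⟨MvPolynomial.C c, MvPolynomial.isHomogeneous_C _ _, fun v => by simp⟩

theorem isForm_dual (l : Dual k V) : IsForm 1 (fun v => l v) :=
  ⟨MvPolynomial.X l, MvPolynomial.isHomogeneous_X _ _, fun v => by simp⟩

theorem IsForm.mul {d e : ℕ} {F G : V → k} (hF : IsForm d F) (hG : IsForm e G) :
    IsForm (d + e) (fun v => F v * G v) := by
  obtain ⟨p, hp, h⟩ := hF
  obtain ⟨q, hq, h'⟩ := hG
  exact ⟨p * q, hp.mul hq, fun v => by simp [h, h']⟩

theorem IsForm.const_mul {d : ℕ} {F : V → k} (c : k) (hF : IsForm d F) :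
    IsForm d (fun v => c * F v) := by
  simpa using (isForm_const c).mul hF

theorem IsForm.pow {d : ℕ} {F : V → k} (hF : IsForm d F) (m : ℕ) :
    IsForm (d * m) (fun v => F v ^ m) := by
  obtain ⟨p, hp, h⟩ := hF
  exact ⟨p ^ m, hp.pow m, fun v => by simp [h]⟩

theorem isForm_dual_pow (l : Dual k V) (m : ℕ) : IsForm m (fun v => l v ^ m) := by
  simpa using (isForm_dual l).pow m

theorem IsForm.sum {ι : Type*} (s : Finset ι) {d : ℕ} {F : ι → V → k}
    (hF : ∀ i ∈ s, IsForm d (F i)) : IsForm d (fun v => ∑ i ∈ s, F i v) := by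
  classical
  induction s using Finset.induction_on with
  | empty => exact ⟨0, MvPolynomial.isHomogeneous_zero _ _ _, fun v => by simp [evalForm]⟩
  | insert a s ha ih =>
    obtain ⟨p, hp, h⟩ := hF a (Finset.mem_insert_self _ _)
    obtain ⟨q, hq, h'⟩ := ih fun i hi => hF i (Finset.mem_insert_of_mem hi)
    exact ⟨p + q, hp.add hq, fun v => by simp [Finset.sum_insert ha, h, h']⟩

theorem IsForm.prod {ι : Type*} (s : Finset ι) {d : ι → ℕ} {F : ι → V → k}
    (hF : ∀ i ∈ s, IsForm (d i) (F i)) : IsForm (∑ i ∈ s, d i) (fun v => ∏ i ∈ s, F i v) := by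
  classical
  induction s using Finset.induction_on with
  | empty => simpa using isForm_const (V := V) (1 : k)
  | insert a s ha ih =>
    simp only [Finset.sum_insert ha, Finset.prod_insert ha]
    exact (hF a (Finset.mem_insert_self _ _)).mul
      (ih fun i hi => hF i (Finset.mem_insert_of_mem hi))

theorem IsForm.restrict {d : ℕ} {F : V → k} (hF : IsForm d F) (W : Submodule k V) :
    IsForm d (fun w : W => F w) := by
  obtain ⟨p, hp, h⟩ := hF
  exact ⟨restrictForm W p, hp.rename_isHomogeneous, fun v =>
    (h v).trans (evalForm_restrictForm W p v).symm⟩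

/-- Restriction to an affine line, which reduces statements on units to one variable. -/
theorem IsForm.exists_polynomial {d : ℕ} {F : V → k} (hF : IsForm d F) (v w : V) :
    ∃ P : Polynomial k, ∀ t : k, F (v + t • w) = P.eval t := by
  obtain ⟨p, -, h⟩ := hF
  refine ⟨MvPolynomial.aeval (fun l : Dual k V =>
    Polynomial.C (l v) + Polynomial.X * Polynomial.C (l w)) p, fun t => ?_⟩
  rw [h, evalForm, ← Polynomial.coe_evalRingHom, ← MvPolynomial.aeval_eq_eval,
    MvPolynomial.aeval_def, MvPolynomial.aeval_def, MvPolynomial.hom_eval₂]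
  congr 1
  · ext c; simp
  · funext l; simp only [map_add, map_smul, smul_eq_mul,
      Polynomial.coe_evalRingHom, Polynomial.eval_mul, Polynomial.eval_C,
      Polynomial.eval_X]

/-- Polynomials in all the linear forms of `V` are not determined by their values, as the linear
forms satisfy linear relations. In the coordinates of a basis they are, over an infinite field, so
identities of functions become identities of polynomials. -/
theorem IsForm.exists_mvPolynomial {d : ℕ} {F : V → k} (hF : IsForm d F) {σ : Type*} [Fintype σ]
    (e : Basis σ k V) : ∃ p : MvPolynomial σ k, p.IsHomogeneous d ∧
      ∀ v, F v = MvPolynomial.eval (e.repr v) p := by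
  obtain ⟨p, hp, h⟩ := hF
  refine ⟨MvPolynomial.aeval (fun l : Dual k V =>
    ∑ i, MvPolynomial.C (l (e i)) * MvPolynomial.X i) p, ?_, fun v => ?_⟩
  · have := hp.aeval (fun l : Dual k V =>
      ∑ i, MvPolynomial.C (l (e i)) * (MvPolynomial.X i : MvPolynomial σ k)) (n := 1)
      fun l => MvPolynomial.IsHomogeneous.sum _ _ _ fun i _ =>
        MvPolynomial.isHomogeneous_C_mul_X _ _
    simpa using this
  · rw [h, evalForm, MvPolynomial.aeval_def, MvPolynomial.hom_eval₂, ← MvPolynomial.aeval_eq_eval,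
      MvPolynomial.aeval_def]
    congr 1
    · ext c; simp
    · funext l
      conv_lhs => rw [← e.sum_repr v]
      simp only [map_sum, map_smul, smul_eq_mul, map_mul, MvPolynomial.eval_C,
        MvPolynomial.eval_X]
      exact Finset.sum_congr rfl fun i _ => mul_comm _ _

theorem isForm_of_mvPolynomial {d : ℕ} {σ : Type*} [Fintype σ] (e : Basis σ k V)
    {p : MvPolynomial σ k} (hp : p.IsHomogeneous d) :
    IsForm d (fun v => MvPolynomial.eval (e.repr v) p) :=
  ⟨MvPolynomial.rename e.coord p, hp.rename_isHomogeneous, fun v => by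
    simp [evalForm, MvPolynomial.eval_rename, Function.comp_def]⟩

theorem multilinear_expand {ι κ B : Type*} [Fintype ι] [DecidableEq ι] [Fintype κ] [AddCommGroup B]
    [Module k B] (D : MultilinearMap k (fun _ : ι => B) k) (e : Basis κ k B) (b : ι → B) :
    D b = ∑ β : ι → κ, (∏ i, e.repr (b i) (β i)) * D fun i => e (β i) := by
  conv_lhs => rw [← funext fun i => e.sum_repr (b i)]
  rw [D.map_sum]
  exact Finset.sum_congr rfl fun β _ => D.map_smul_univ _ _

theorem IsForm.multilinear {ι κ B : Type*} [Fintype ι] [Fintype κ] [AddCommGroup B]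
    [Module k B] (D : MultilinearMap k (fun _ : ι => B) k) (e : Basis κ k B) {d : ι → ℕ}
    {L : ι → V → B} (hL : ∀ i j, IsForm (d i) fun v => e.repr (L i v) j) :
    IsForm (∑ i, d i) fun v => D fun i => L i v := by
  classical
  have h : (fun v => D fun i => L i v) = fun v =>
      ∑ β : ι → κ, (D fun i => e (β i)) * ∏ i, e.repr (L i v) (β i) := by
    funext v
    rw [multilinear_expand D e]
    exact Finset.sum_congr rfl fun β _ => mul_comm _ _
  rw [h]
  exact IsForm.sum _ fun β _ => (IsForm.prod _ fun i _ => hL i (β i)).const_mul _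

theorem IsForm.exists_rank_one_factor [Infinite k] [FiniteDimensional k V] {ι κ : Type*}
    [Fintype κ] (Q : ι → κ → V → k) {r : ℕ} (hQ : ∀ i j, IsForm r (Q i j))
    (h1 : ∀ i j i' j' v, Q i j v * Q i' j' v = Q i j' v * Q i' j v)
    {i₀ : ι} {j₀ : κ} {v₀ : V} (h0 : Q i₀ j₀ v₀ ≠ 0) :
    ∃ c ≤ r, ∃ (w : ι → V → k) (u : κ → V → k), (∀ j, IsForm c (u j)) ∧
      ∀ i j v, Q i j v = w i v * u j v := by
  let e := finBasis k V
  choose q hq hqe using fun i j => (hQ i j).exists_mvPolynomial e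
  have hsurj : ∀ x : Fin (finrank k V) → k, ∃ v, ⇑(e.repr v) = x :=
    fun x => ⟨e.equivFun.symm x, e.equivFun.apply_symm_apply x⟩
  obtain ⟨c, hc, w, u, hu, hwu⟩ := ProjSpace.exists_rank_one_factor q hq (fun i j i' j' => by
    refine MvPolynomial.funext fun x => ?_
    obtain ⟨v, rfl⟩ := hsurj x
    simp only [map_mul, ← hqe]
    exact h1 i j i' j' v) (i₀ := i₀) (j₀ := j₀)
    (fun h => h0 (by rw [hqe, h, map_zero]))
  exact ⟨c, hc, fun i v => MvPolynomial.eval (e.repr v) (w i),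
    fun j v => MvPolynomial.eval (e.repr v) (u j), fun j => isForm_of_mvPolynomial e (hu j),
    fun i j v => by rw [hqe, hwu, map_mul]⟩

end Forms

/-! ### Nowhere vanishing regular functions -/

section Units

variable {k : Type*} [Field k] [IsAlgClosed k]

open Polynomial in
-- All the local fractions represent the same rational function. In lowest terms its denominator
-- divides every local denominator, so it has no zero; nor does its numerator, as `g` has none. Over
-- an algebraically closed field both are constants.
theorem exists_eq_const_of_locally_div {g : k → k} (h0 : ∀ t, g t ≠ 0)
    (h : ∀ t₀, ∃ p q : k[X], q.eval t₀ ≠ 0 ∧ ∀ t, q.eval t ≠ 0 → g t = p.eval t / q.eval t) :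
    ∃ c, ∀ t, g t = c := by
  classical
  have : Infinite k := IsAlgClosed.instInfinite
  obtain ⟨p, q, hq, hpq⟩ := h 0
  have hq0 : q ≠ 0 := fun e => hq (by simp [e])
  obtain ⟨p₁, hp₁⟩ := EuclideanDomain.gcd_dvd_left p q
  obtain ⟨q₁, hq₁⟩ := EuclideanDomain.gcd_dvd_right p q
  set d := EuclideanDomain.gcd p q with hd
  have hd0 : d ≠ 0 := fun e => hq0 (by rw [hq₁, e, zero_mul])
  have hcop : IsCoprime p₁ q₁ := by
    refine ⟨EuclideanDomain.gcdA p q, EuclideanDomain.gcdB p q, mul_left_cancel₀ hd0 ?_⟩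
    have := EuclideanDomain.gcd_eq_gcd_ab p q
    rw [← hd] at this
    linear_combination -this - EuclideanDomain.gcdA p q * hp₁ - EuclideanDomain.gcdB p q * hq₁
  have key : ∀ t₀, p₁.eval t₀ ≠ 0 ∧ q₁.eval t₀ ≠ 0 ∧ g t₀ = p₁.eval t₀ / q₁.eval t₀ := by
    intro t₀
    obtain ⟨p', q', hq', hpq'⟩ := h t₀
    have hq'0 : q' ≠ 0 := fun e => hq' (by simp [e])
    have e1 : p * q' = p' * q := by
      -- The factor `q * q'` makes the identity hold also at the points where one of the two
      -- fractions is not available.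
      have : (p * q' - p' * q) * (q * q') = 0 := by
        refine Polynomial.funext fun t => ?_
        by_cases ht : q.eval t = 0
        · simp [ht]
        by_cases ht' : q'.eval t = 0
        · simp [ht']
        have h1 := hpq t ht
        rw [hpq' t ht', div_eq_div_iff ht' ht] at h1
        simp only [eval_mul, eval_sub, eval_zero]
        rw [← h1, sub_self, zero_mul]
      exact sub_eq_zero.mp ((mul_eq_zero.mp this).resolve_right (mul_ne_zero hq0 hq'0))
    have e2 : p₁ * q' = p' * q₁ := by
      refine mul_left_cancel₀ hd0 ?_
      linear_combination e1 - q' * hp₁ + p' * hq₁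
    have e3 := congrArg (eval t₀) e2
    rw [eval_mul, eval_mul] at e3
    obtain ⟨a, ha⟩ : q₁ ∣ q' := hcop.symm.dvd_of_dvd_mul_left ⟨p', by rw [e2]; ring⟩
    have h1 : q₁.eval t₀ ≠ 0 := fun e => hq' (by rw [ha, eval_mul, e, zero_mul])
    have h2 : g t₀ = p₁.eval t₀ / q₁.eval t₀ := by
      rw [hpq' t₀ hq', div_eq_div_iff hq' h1, e3]
    exact ⟨fun e => h0 t₀ (by rw [h2, e, zero_div]), h1, h2⟩
  have hconst : ∀ P : k[X], (∀ t, P.eval t ≠ 0) → ∃ c, ∀ t, P.eval t = c := by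
    intro P hP
    by_cases hdeg : P.degree = 0
    · rw [eq_C_of_degree_eq_zero hdeg]
      exact ⟨_, fun t => eval_C⟩
    · obtain ⟨t, ht⟩ := IsAlgClosed.exists_root P hdeg
      exact absurd ht (hP t)
  obtain ⟨a, ha⟩ := hconst p₁ fun t => (key t).1
  obtain ⟨b, hb⟩ := hconst q₁ fun t => (key t).2.1
  exact ⟨a / b, fun t => by rw [(key t).2.2, ha, hb]⟩

variable {V : Type*} [AddCommGroup V] [Module k V]

/-- On the affine lines `v₁ + k v₂` and `v₂ + k v₁` the function `h` is constant, with values `a`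
and `b`. As `v₁ + t v₂ = t (v₂ + t⁻¹ v₁)`, homogeneity gives `a = t ^ e * b` for all `t ≠ 0`, which
in an infinite field forces `e = 0`. -/
theorem degree_eq_zero_of_ne_zero {v₁ v₂ : V}
    (hv : ∀ s t : k, s • v₁ + t • v₂ = 0 → s = 0 ∧ t = 0) {h : V → k} {e : ℤ}
    (hh : ∀ v ≠ 0, ∀ t : k, t ≠ 0 → h (t • v) = t ^ e * h v) (h0 : ∀ v ≠ 0, h v ≠ 0)
    (hloc : ∀ v ≠ 0, ∃ (c d : ℕ) (P Q : V → k), IsForm c P ∧ IsForm d Q ∧ Q v ≠ 0 ∧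
      ∀ w ≠ 0, Q w ≠ 0 → h w = P w / Q w) : e = 0 := by
  have : Infinite k := IsAlgClosed.instInfinite
  have hline : ∀ v w : V, (∀ t : k, v + t • w ≠ 0) → ∃ c, ∀ t : k, h (v + t • w) = c := by
    intro v w hvw
    refine exists_eq_const_of_locally_div (g := fun t => h (v + t • w))
      (fun t => h0 _ (hvw t)) fun t₀ => ?_
    obtain ⟨_, _, P, Q, hP, hQ, hne, hPQ⟩ := hloc _ (hvw t₀)
    obtain ⟨p, hp⟩ := hP.exists_polynomial v w
    obtain ⟨q, hq⟩ := hQ.exists_polynomial v w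
    exact ⟨p, q, hq t₀ ▸ hne, fun t ht => by rw [hPQ _ (hvw t) (by rwa [hq]), hp, hq]⟩
  obtain ⟨a, ha⟩ := hline v₁ v₂ fun t e =>
    one_ne_zero (hv 1 t (by rw [one_smul]; exact e)).1
  obtain ⟨b, hb⟩ := hline v₂ v₁ fun t e =>
    one_ne_zero (hv t 1 (by rw [one_smul, add_comm]; exact e)).2
  have hne : ∀ t : k, v₂ + t • v₁ ≠ 0 := fun t e =>
    one_ne_zero (hv t 1 (by rw [one_smul, add_comm]; exact e)).2
  have hb0 : b ≠ 0 := hb 0 ▸ h0 _ (hne 0)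
  have key : ∀ t : k, t ≠ 0 → a = t ^ e * b := by
    intro t ht
    rw [← ha t, ← hb t⁻¹, ← hh _ (hne _) t ht]
    congr 1
    rw [smul_add, smul_smul, mul_inv_cancel₀ ht, one_smul, add_comm]
  have hab : a = b := by simpa using key 1 one_ne_zero
  have key' : ∀ t : k, t ≠ 0 → t ^ e = 1 := fun t ht => by
    have := key t ht
    rw [hab] at this
    exact mul_right_cancel₀ hb0 (by rw [← this, one_mul])
  by_contra hne0
  have hm : 0 < e.natAbs := Int.natAbs_pos.mpr hne0
  have hpow : ∀ t : k, t ≠ 0 → t ^ e.natAbs = 1 := by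
    intro t ht
    rcases Int.natAbs_eq e with h1 | h1
    · have := key' t ht
      rwa [h1, zpow_natCast] at this
    · have := key' t ht
      rw [h1, zpow_neg, zpow_natCast, inv_eq_one] at this
      exact this
  -- The factor `X` takes care of `t = 0`, where `t ^ |e| = 1` is not known.
  have hinf : (Polynomial.X ^ e.natAbs - 1 : Polynomial k) * Polynomial.X = 0 := by
    refine Polynomial.funext fun t => ?_
    by_cases ht : t = 0
    · simp [ht]
    · simp [hpow t ht]
  rcases mul_eq_zero.mp hinf with h1 | h1
  · have := Polynomial.X_pow_sub_C_ne_zero hm (1 : k)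
    rw [map_one] at this
    exact this h1
  · exact Polynomial.X_ne_zero h1

end Units

/-! ### Pencils of linear maps of constant rank -/

section Pencil

variable {k : Type*} [Field k]
  {A : Type*} [AddCommGroup A] [Module k A]
  {B : Type*} [AddCommGroup B] [Module k B]

/-- The numerator `∑ cᵢ tⁱ` and the denominator `δ(t)` of `(1 - tT)⁻¹ a`. -/
theorem exists_resolvent [FiniteDimensional k A] (T : A →ₗ[k] A) : ∃ (δ : Polynomial k) (N : ℕ), δ ≠ 0 ∧
    ∀ a : A, ∃ c : ℕ → A, c 0 = a ∧ (∀ i, c (i + 1) = T (c i) + δ.coeff (i + 1) • a) ∧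
      (∀ i, N ≤ i → c i = 0) ∧
      ∀ t : k, ∑ i ∈ Finset.range N, t ^ i • c i - t • T (∑ i ∈ Finset.range N, t ^ i • c i) =
        δ.eval t • a := by
  set m := minpoly k T with hm
  have hmon : m.Monic := minpoly.monic (Algebra.IsIntegral.isIntegral T)
  refine ⟨m.reverse, m.natDegree + 1, ?_, fun a => ?_⟩
  · rw [Ne, Polynomial.reverse_eq_zero]
    exact hmon.ne_zero
  -- These are the coefficients of `δ(t) ∑ tⁱ Tⁱ a`, with `δ` the reversed minimal polynomial `m`.
  -- The one of index `deg m` is `m(T) a = 0`, and `δ` has no term beyond that degree, so the series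
  -- stops.
  set c : ℕ → A := fun i => ∑ j ∈ Finset.range (i + 1), m.reverse.coeff j • (T ^ (i - j)) a with hc
  have h0 : c 0 = a := by simp [hc, hmon.leadingCoeff]
  have hs : ∀ i, c (i + 1) = T (c i) + m.reverse.coeff (i + 1) • a := by
    intro i
    simp only [hc]
    rw [Finset.sum_range_succ _ (i + 1), map_sum]
    congr 1
    · refine Finset.sum_congr rfl fun j hj => ?_
      have : i + 1 - j = (i - j) + 1 := by have := Finset.mem_range.mp hj; omega
      rw [this, pow_succ', map_smul]
      rfl
    · simp
  have hn : c m.natDegree = 0 := by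
    have h1 : Polynomial.aeval T m a = 0 := by rw [hm, minpoly.aeval]; rfl
    rw [Polynomial.aeval_eq_sum_range, LinearMap.sum_apply, ← Finset.sum_range_reflect] at h1
    rw [← h1]
    refine Finset.sum_congr rfl fun j hj => ?_
    have hj' : j ≤ m.natDegree := by have := Finset.mem_range.mp hj; omega
    rw [Polynomial.coeff_reverse, Polynomial.revAt_le hj', LinearMap.smul_apply]
    simp
  have hdeg : m.reverse.natDegree < m.natDegree + 1 :=
    Nat.lt_succ_of_le (Polynomial.reverse_natDegree_le m)
  refine ⟨c, h0, hs, fun i hi => ?_, fun t => ?_⟩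
  · have key : ∀ j, c (m.natDegree + j) = 0 := by
      intro j
      induction j with
      | zero => exact hn
      | succ j ih =>
        rw [← add_assoc, hs, ih, map_zero, Polynomial.coeff_eq_zero_of_natDegree_lt (by omega),
          zero_smul, add_zero]
    obtain ⟨j, rfl⟩ := Nat.exists_eq_add_of_le (Nat.le_of_succ_le hi)
    exact key j
  -- The recursion makes the sum telescope; at `M = deg m` the remaining term vanishes.
  · have key : ∀ M, ∑ i ∈ Finset.range (M + 1), t ^ i • c i -
        t • T (∑ i ∈ Finset.range (M + 1), t ^ i • c i) =
        (∑ i ∈ Finset.range (M + 1), m.reverse.coeff i * t ^ i) • a - t ^ (M + 1) • T (c M) := by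
      intro M
      induction M with
      | zero => simp [h0, hmon.leadingCoeff]
      | succ M ih =>
        rw [Finset.sum_range_succ _ (M + 1), Finset.sum_range_succ _ (M + 1), map_add, smul_add,
          add_sub_add_comm, ih, hs M, map_smul, map_add, map_smul]
        module
    rw [key, hn, map_zero, smul_zero, sub_zero, Polynomial.eval_eq_sum_range' hdeg]

/-- A vector of the kernel of a member of a pencil of constant rank extends to a formal vector
`∑ cᵢ tⁱ` of the kernel of the pencil. -/
theorem exists_formal_kernel [FiniteDimensional k A] [Infinite k] (f g : A →ₗ[k] B)
    (hr : ∀ t : k, finrank k (LinearMap.range (f + t • g)) = finrank k (LinearMap.range f))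
    {a : A} (ha : f a = 0) : ∃ c : ℕ → A, c 0 = a ∧ ∀ i, f (c (i + 1)) = - g (c i) := by
  obtain ⟨P, hP⟩ := (LinearMap.range f).subtype.exists_leftInverse_of_injective
    (Submodule.ker_subtype _)
  obtain ⟨σ, hσ⟩ := f.rangeRestrict.exists_rightInverse_of_surjective f.range_rangeRestrict
  have hP' : ∀ z : LinearMap.range f, P z = z := fun z => LinearMap.congr_fun hP z
  have hσ' : ∀ z, f (σ z) = z := fun z => congrArg Subtype.val (LinearMap.congr_fun hσ z)
  -- With `P` a projection onto the image of `f` and `σ` a section of `f`, the equation `P ((f + t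
  -- g) y) = 0` follows from `(1 + t σ P g) y = δ(t) a`; the resolvent solves the latter
  -- polynomially in `t`.
  obtain ⟨δ, N, hδ, h⟩ := exists_resolvent (-(σ ∘ₗ P ∘ₗ g))
  obtain ⟨c, hc0, hcs, hcN, hct⟩ := h a
  -- The resolvent shows that `1 + t σ P g` is surjective when `δ(t) ≠ 0`, hence injective by finite
  -- dimension.
  have hinj : ∀ t : k, δ.eval t ≠ 0 → ∀ y : A, y + t • σ (P (g y)) = 0 → y = 0 := by
    intro t ht
    have hs : Function.Surjective (LinearMap.id + t • (σ ∘ₗ P ∘ₗ g) : A →ₗ[k] A) := by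
      intro z
      obtain ⟨c, -, -, -, hc⟩ := h ((δ.eval t)⁻¹ • z)
      refine ⟨∑ i ∈ Finset.range N, t ^ i • c i, ?_⟩
      have := hc t
      rw [smul_smul, mul_inv_cancel₀ ht, one_smul] at this
      rw [← this, LinearMap.neg_apply, smul_neg, sub_neg_eq_add]
      rfl
    intro y hy
    exact (LinearMap.injective_iff_surjective.mpr hs) (by rw [map_zero]; exact hy)
  -- Here constant rank enters: `P (f + t g) σ` is injective on the image of `f`, so `P` maps the
  -- image of `f + t g` onto that of `f`. The two have the same dimension, so `P` loses nothing on
  -- the image of `f + t g`.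
  have hker : ∀ t : k, δ.eval t ≠ 0 → ∀ b ∈ LinearMap.range (f + t • g), P b = 0 → b = 0 := by
    intro t ht
    have hsurj : Function.Surjective (P.domRestrict (LinearMap.range (f + t • g))) := by
      have h1 : Function.Injective (P ∘ₗ (f + t • g) ∘ₗ σ) := by
        refine (injective_iff_map_eq_zero _).mpr fun z hz => ?_
        have h2 : P (f (σ z)) = z := by rw [hσ', hP']
        simp only [LinearMap.comp_apply, LinearMap.add_apply, LinearMap.smul_apply, map_add,
          map_smul, h2] at hz
        have h3 := hinj t ht (σ z) (by rw [← map_smul, ← map_add, hz, map_zero])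
        have h4 := hσ' z
        rw [h3, map_zero] at h4
        exact Subtype.ext h4.symm
      intro z
      obtain ⟨y, rfl⟩ := LinearMap.injective_iff_surjective.mp h1 z
      exact ⟨⟨_, LinearMap.mem_range_self _ (σ y)⟩, rfl⟩
    have hinj' := (LinearMap.injective_iff_surjective_of_finrank_eq_finrank (hr t)).mpr hsurj
    intro b hb h0
    exact congrArg Subtype.val
      (hinj' (a₁ := ⟨b, hb⟩) (a₂ := 0) (by rw [map_zero]; exact h0))
  have hzero : ∀ t : k, δ.eval t ≠ 0 →
      (f + t • g) (∑ i ∈ Finset.range N, t ^ i • c i) = 0 := by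
    intro t ht
    refine hker t ht _ (LinearMap.mem_range_self _ _) ?_
    have h1 := congrArg f (hct t)
    generalize ∑ i ∈ Finset.range N, t ^ i • c i = y at h1 ⊢
    simp only [LinearMap.neg_apply, LinearMap.comp_apply, smul_neg, sub_neg_eq_add, map_add,
      map_smul, ha, smul_zero, hσ'] at h1
    have h2 := congrArg P h1
    simpa [hP'] using h2
  -- A functional `l` vanishing on the image of `f` satisfies `t ∑ tⁱ l (g (c i)) = 0` whenever
  -- `δ(t) ≠ 0`, so all the coefficients vanish. The factor `X * δ` below absorbs the excluded
  -- values of `t`.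
  have hrange : ∀ i, g (c i) ∈ LinearMap.range f := by
    intro i
    by_contra hi
    obtain ⟨l, hl, hl'⟩ := Submodule.exists_le_ker_of_notMem hi
    have hp : (∑ i ∈ Finset.range N, Polynomial.C (l (g (c i))) * Polynomial.X ^ i) *
        (Polynomial.X * δ) = 0 := by
      refine Polynomial.funext fun t => ?_
      by_cases ht : δ.eval t = 0
      · simp [ht]
      · have h1 := congrArg l (hzero t ht)
        rw [LinearMap.add_apply, map_add, show l (f _) = 0 from
          hl' (LinearMap.mem_range_self _ _), zero_add] at h1
        simp only [LinearMap.smul_apply, map_smul, map_sum, smul_eq_mul, map_zero] at h1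
        simp only [Polynomial.eval_mul, Polynomial.eval_finsetSum, Polynomial.eval_C,
          Polynomial.eval_pow, Polynomial.eval_X, Polynomial.eval_zero]
        simp only [mul_left_comm _ t, ← Finset.mul_sum] at h1
        simp only [mul_comm (l _)]
        rw [mul_left_comm, ← mul_assoc, h1, zero_mul]
    have hp' := (mul_eq_zero.mp hp).resolve_right (mul_ne_zero Polynomial.X_ne_zero hδ)
    have hco := congrArg (fun p => Polynomial.coeff p i) hp'
    simp only [Polynomial.finsetSum_coeff, Polynomial.coeff_C_mul, Polynomial.coeff_X_pow,
      mul_ite, mul_one, mul_zero, Finset.sum_ite_eq, Polynomial.coeff_zero] at hco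
    by_cases hiN : i < N
    · rw [if_pos (Finset.mem_range.mpr hiN)] at hco
      exact hl hco
    · exact hi (by rw [hcN i (not_lt.mp hiN), map_zero]; exact Submodule.zero_mem _)
  refine ⟨c, hc0, fun i => ?_⟩
  rw [hcs]
  have h1 := congrArg Subtype.val (hP' ⟨_, hrange i⟩)
  simp only [map_add, map_smul, ha, smul_zero, add_zero, LinearMap.neg_apply, map_neg,
    LinearMap.comp_apply, hσ', h1]

/-- Dividing by a subspace common to all the images lowers all the ranks equally, so a pencil of
constant rank stays one modulo `commonRange W`. -/
theorem finrank_range_mkQ_comp [FiniteDimensional k A] (S : Submodule k B) (f : A →ₗ[k] B)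
    (hS : S ≤ LinearMap.range f) :
    finrank k (LinearMap.range (S.mkQ ∘ₗ f)) + finrank k S = finrank k (LinearMap.range f) := by
  have h := (S.mkQ.domRestrict (LinearMap.range f)).finrank_range_add_finrank_ker
  rw [LinearMap.range_domRestrict, ← LinearMap.range_comp, LinearMap.ker_domRestrict,
    Submodule.ker_mkQ] at h
  rw [← h, ← (Submodule.comapSubtypeEquivOfLe hS).finrank_eq]

/-- The vectors which belong to the image of every nonzero member of `W`. -/
def commonRange (W : Submodule k (A →ₗ[k] B)) : Submodule k B :=
  ⨅ (f : A →ₗ[k] B) (_ : f ∈ W ∧ f ≠ 0), LinearMap.range f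

theorem commonRange_le {W : Submodule k (A →ₗ[k] B)} {f : A →ₗ[k] B} (hf : f ∈ W) (h0 : f ≠ 0) :
    commonRange W ≤ LinearMap.range f :=
  iInf₂_le f ⟨hf, h0⟩

/-- The image of each `f` contains `commonRange W`, so solving `f a = b` modulo that subspace is
enough. This lets the argument run entirely in the quotient. -/
theorem mem_commonRange {W : Submodule k (A →ₗ[k] B)} {b : B}
    (h : ∀ f ∈ W, f ≠ 0 → ∃ a, f a - b ∈ commonRange W) : b ∈ commonRange W := by
  simp only [commonRange, Submodule.mem_iInf]
  rintro f ⟨hf, h0⟩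
  obtain ⟨a, ha⟩ := h f hf h0
  have := commonRange_le hf h0 ha
  have h1 := sub_mem (LinearMap.mem_range_self f a) this
  rwa [sub_sub_cancel] at h1

/-- Extend a kernel vector `a` of `f` modulo the common range to a formal kernel vector `∑ cᵢ tⁱ` of
`f + t g`. All the `g (c i)` lie in the image of every nonzero member of the pencil modulo the
common range, so in the common range itself; the case `i = 0` is the claim. Exchanging `f` and `g`
shows that the kernels are equal. -/
theorem ker_mkQ_comp_le [Infinite k] [FiniteDimensional k A]
    {W : Submodule k (A →ₗ[k] B)} (hW : finrank k W = 2) {r : ℕ}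
    (hr : HasConstantRank W r) {f g : A →ₗ[k] B} (hf : f ∈ W) (hg : g ∈ W) (h0 : f ≠ 0) :
    LinearMap.ker ((commonRange W).mkQ ∘ₗ f) ≤ LinearMap.ker ((commonRange W).mkQ ∘ₗ g) := by
  set q := (commonRange W).mkQ with hq
  have hfin : FiniteDimensional k W := Module.finite_of_finrank_pos (by omega)
  have hrank : ∀ h ∈ W, h ≠ 0 →
      finrank k (LinearMap.range (q ∘ₗ h)) + finrank k (commonRange W) = r :=
    fun h hh hh0 => (finrank_range_mkQ_comp _ h (commonRange_le hh hh0)).trans (hr h hh hh0)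
  by_cases hfg : LinearIndependent k ![f, g]
  · have hspan : Submodule.span k (Set.range ![f, g]) = W := by
      refine Submodule.eq_of_le_of_finrank_eq ?_ ?_
      · rw [Submodule.span_le]
        rintro _ ⟨i, rfl⟩
        fin_cases i
        · exact hf
        · exact hg
      · rw [finrank_span_eq_card hfg, hW, Fintype.card_fin]
    rw [LinearIndependent.pair_iff] at hfg
    intro a ha
    obtain ⟨c, hc0, hc⟩ := exists_formal_kernel (q ∘ₗ f) (q ∘ₗ g) (fun t => by
      have h1 := hrank (f + t • g) (add_mem hf (W.smul_mem t hg)) (fun h => one_ne_zero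
        (hfg 1 t (by rw [one_smul]; exact h)).1)
      have h2 := hrank f hf h0
      rw [LinearMap.comp_add, LinearMap.comp_smul] at h1
      omega) ha
    have key : ∀ i, g (c i) ∈ commonRange W := by
      intro i
      refine mem_commonRange fun x hx hx0 => ?_
      rw [← hspan, Matrix.range_cons, Matrix.range_cons, Matrix.range_empty, Set.union_empty,
        Set.singleton_union, Submodule.mem_span_pair] at hx
      obtain ⟨s, t, rfl⟩ := hx
      have hmem : ∀ b, b ∈ commonRange W ↔ q b = 0 := fun b =>
        (Submodule.Quotient.mk_eq_zero _).symm
      simp only [hmem, map_sub, LinearMap.add_apply, LinearMap.smul_apply, map_add, map_smul,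
        sub_eq_zero]
      simp only [LinearMap.comp_apply] at hc
      -- For a multiple `s f` of `f`, the preimage is read off from `f (c (i + 1)) = -g (c i)`.
      -- Otherwise a preimage `y` of `g (c i)` under `s f + t g` gives the preimage `t⁻¹ (c (i + 1)
      -- + s y)` of `g (c (i + 1))`, the terms in `g (c i)` cancelling.
      by_cases ht : t = 0
      · have hs : s ≠ 0 := fun e => hx0 (by rw [e, ht, zero_smul, zero_smul, add_zero])
        refine ⟨-(s⁻¹ • c (i + 1)), ?_⟩
        rw [ht, zero_smul, add_zero, map_neg, map_neg, map_smul, map_smul, hc, smul_neg, smul_smul,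
          mul_inv_cancel₀ hs, one_smul, neg_neg]
      · induction i with
        | zero =>
          refine ⟨t⁻¹ • c 0, ?_⟩
          have h1 : q (f (c 0)) = 0 := by rw [hc0]; exact ha
          simp only [map_smul, h1, smul_zero, zero_add, smul_smul, mul_inv_cancel₀ ht, one_smul]
        | succ i ih =>
          obtain ⟨y, hy⟩ := ih
          refine ⟨t⁻¹ • (c (i + 1) + s • y), ?_⟩
          simp only [map_smul, map_add, hc]
          have h2 : s • q (f y) = q (g (c i)) - t • q (g y) := by rw [← hy]; abel
          have h3 : q (g (c (i + 1))) = (t * t⁻¹) • q (g (c (i + 1))) := by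
            rw [mul_inv_cancel₀ ht, one_smul]
          conv_rhs => rw [h3]
          rw [smul_add, smul_add, smul_comm s, h2]
          module
    have h1 := key 0
    rw [hc0] at h1
    exact (Submodule.Quotient.mk_eq_zero _).mpr h1
  · rw [LinearIndependent.pair_iff' h0] at hfg
    push Not at hfg
    obtain ⟨t, rfl⟩ := hfg
    intro a ha
    rw [LinearMap.mem_ker] at ha ⊢
    rw [LinearMap.comp_smul, LinearMap.smul_apply, ha, smul_zero]

/-- The images of the members of a pencil of constant rank are spanned by the images of some fixed
vectors and by some fixed vectors. -/
theorem exists_pencil_frame [Infinite k] [FiniteDimensional k A] [FiniteDimensional k B]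
    {W : Submodule k (A →ₗ[k] B)} (hW : finrank k W = 2)
    {r : ℕ} (hr : HasConstantRank W r) :
    ∃ c ≤ r, ∃ (α : Fin r → A) (β : Fin r → B), ∀ f ∈ W, f ≠ 0 →
      LinearIndependent k (fun i : Fin r => if (i : ℕ) < c then f (α i) else β i) ∧
      ∀ i : Fin r, (if (i : ℕ) < c then f (α i) else β i) ∈ LinearMap.range f := by
  have hWne : W ≠ ⊥ := fun e => by rw [e, finrank_bot] at hW; omega
  obtain ⟨f₀, hf₀, h₀⟩ := W.ne_bot_iff.mp hWne
  set S := commonRange W with hS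
  obtain ⟨C, hC⟩ := Submodule.exists_isCompl (LinearMap.ker (S.mkQ ∘ₗ f₀))
  have h1 := (finrank_range_mkQ_comp S f₀ (commonRange_le hf₀ h₀)).trans (hr f₀ hf₀ h₀)
  have h2 := Submodule.finrank_add_eq_of_isCompl hC
  have h3 := (S.mkQ ∘ₗ f₀).finrank_range_add_finrank_ker
  have hCr : finrank k C + finrank k S = r := by omega
  -- The vectors of `C` come first, so that the test `i < dim C` selects them. The zeros in the two
  -- families below are dummy values, never used by the test.
  let e : Fin (finrank k C) ⊕ Fin (finrank k S) ≃ Fin r :=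
    finSumFinEquiv.trans (finCongr hCr)
  let a := finBasis k C
  let b := finBasis k S
  refine ⟨finrank k C, by omega, fun i => Sum.elim (fun j => (a j : A)) 0 (e.symm i),
    fun i => Sum.elim 0 (fun j => (b j : B)) (e.symm i), fun f hf h0 => ?_⟩
  have hfam : ∀ x, (if (e x : ℕ) < finrank k C then
      f (Sum.elim (fun j => (a j : A)) 0 (e.symm (e x))) else
      Sum.elim 0 (fun j => (b j : B)) (e.symm (e x))) =
      Sum.elim (fun j => f (a j)) (fun j => (b j : B)) x := by
    intro x
    rw [e.symm_apply_apply]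
    rcases x with x | x
    · rw [if_pos (by simp [e])]; rfl
    · rw [if_neg (by simp [e])]; rfl
  refine ⟨?_, fun i => ?_⟩
  · rw [← linearIndependent_equiv e]
    change LinearIndependent k fun x => if (e x : ℕ) < finrank k C then
      f (Sum.elim (fun j => (a j : A)) 0 (e.symm (e x))) else
      Sum.elim 0 (fun j => (b j : B)) (e.symm (e x))
    rw [funext hfam]
    -- The complement `C` is chosen for `f₀`; that it serves every other `f` is the independence of
    -- the kernel from the member of the pencil.
    have hker : Disjoint C (LinearMap.ker (S.mkQ ∘ₗ f)) :=
      hC.disjoint.symm.mono_right (ker_mkQ_comp_le hW hr hf hf₀ h0)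
    have hf1 : LinearIndependent k fun j => (S.mkQ ∘ₗ f) (a j) := by
      refine LinearIndependent.map (v := fun j => (a j : A)) ?_ ?_
      · exact a.linearIndependent.map' C.subtype (Submodule.ker_subtype _)
      · refine hker.mono_left ?_
        rw [Submodule.span_le]
        rintro _ ⟨j, rfl⟩
        exact (a j).2
    refine LinearIndependent.sum_type ?_ ?_ ?_
    · exact LinearIndependent.of_comp S.mkQ hf1
    · exact b.linearIndependent.map' S.subtype (Submodule.ker_subtype _)
    · have hb : Submodule.span k (Set.range fun j => (b j : B)) ≤ S := by
        rw [Submodule.span_le]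
        rintro _ ⟨j, rfl⟩
        exact (b j).2
      refine Disjoint.mono_right hb ?_
      rw [Submodule.disjoint_def]
      intro x hx hxS
      obtain ⟨t, rfl⟩ := (Submodule.mem_span_range_iff_exists_fun k).mp hx
      have h4 : ∑ j, t j • (S.mkQ ∘ₗ f) (a j) = 0 := by
        have := (Submodule.Quotient.mk_eq_zero S).mpr hxS
        rw [← Submodule.mkQ_apply, map_sum] at this
        simpa using this
      have h5 := Fintype.linearIndependent_iff.mp hf1 t h4
      simp [h5]
  · obtain ⟨x, rfl⟩ := e.surjective i
    change (if (e x : ℕ) < finrank k C then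
      f (Sum.elim (fun j => (a j : A)) 0 (e.symm (e x))) else
      Sum.elim 0 (fun j => (b j : B)) (e.symm (e x))) ∈ _
    rw [hfam]
    rcases x with x | x
    · exact LinearMap.mem_range_self _ _
    · exact commonRange_le hf h0 (b x).2

end Pencil

/-! ### The determinant of the cokernel as a family of alternating forms -/

section Volume

variable {k : Type*} [Field k] {B : Type*} [AddCommGroup B] [Module k B]

/-- The alternating form obtained by fixing the first family of arguments. -/
def rightForm {ι κ : Type*} (D : B [⋀^ι ⊕ κ]→ₗ[k] k) (w : ι → B) : B [⋀^κ]→ₗ[k] k where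
  toFun b := D (Sum.elim w b)
  map_update_add' b j x y := by
    classical
    simp only [Sum.elim_update_right, AlternatingMap.map_update_add]
  map_update_smul' b j t x := by
    classical
    simp only [Sum.elim_update_right, AlternatingMap.map_update_smul]
  map_eq_zero_of_eq' b i j hij hne :=
    D.map_eq_zero_of_eq _ (i := .inr i) (j := .inr j) hij fun h => hne (Sum.inr_injective h)

/-- The alternating form obtained by fixing the second family of arguments. -/
def leftForm {ι κ : Type*} (D : B [⋀^ι ⊕ κ]→ₗ[k] k) (b : κ → B) : B [⋀^ι]→ₗ[k] k where
  toFun w := D (Sum.elim w b)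
  map_update_add' w j x y := by
    classical
    simp only [Sum.elim_update_left, AlternatingMap.map_update_add]
  map_update_smul' w j t x := by
    classical
    simp only [Sum.elim_update_left, AlternatingMap.map_update_smul]
  map_eq_zero_of_eq' b i j hij hne :=
    D.map_eq_zero_of_eq _ (i := .inl i) (j := .inl j) hij fun h => hne (Sum.inl_injective h)

theorem exists_volume [FiniteDimensional k B] {r : ℕ} (hr : r ≤ finrank k B) :
    ∃ D : B [⋀^Fin r ⊕ Fin (finrank k B - r)]→ₗ[k] k,
      ∀ v, LinearIndependent k v → D v ≠ 0 := by
  let ε : Fin r ⊕ Fin (finrank k B - r) ≃ Fin (finrank k B) :=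
    finSumFinEquiv.trans (finCongr (by omega))
  refine ⟨((finBasis k B).reindex ε.symm).det, fun v hv => ?_⟩
  rw [← isUnit_iff_ne_zero, ← Basis.is_basis_iff_det]
  exact ⟨hv, hv.span_eq_top_of_card_eq_finrank' (by
    rw [Fintype.card_sum, Fintype.card_fin, Fintype.card_fin]; omega)⟩

/-- Two families of vectors of a subspace of dimension `r` have proportional determinants. -/
theorem det_elim_mul_comm {κ : Type*} {r : ℕ} (D : B [⋀^Fin r ⊕ κ]→ₗ[k] k) (R : Submodule k B)
    [FiniteDimensional k R] (hR : finrank k R = r) {a a' : Fin r → B} (ha : ∀ i, a i ∈ R)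
    (ha' : ∀ i, a' i ∈ R) (b b' : κ → B) :
    D (Sum.elim a b) * D (Sum.elim a' b') = D (Sum.elim a b') * D (Sum.elim a' b) := by
  let e := finBasisOfFinrankEq k R hR
  have h : ∀ (x : κ → B) (c : Fin r → B) (hc : ∀ i, c i ∈ R), D (Sum.elim c x) =
      D (Sum.elim (fun i => (e i : B)) x) * e.det fun i => ⟨c i, hc i⟩ := by
    intro x c hc
    -- Alternating `r`-forms on the `r`-dimensional `R` are multiples of one determinant, so `D`
    -- restricted to `R` in its first arguments factors.
    have h1 := ((leftForm D x).compLinearMap R.subtype).eq_smul_basis_det e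
    exact congrArg (fun F : R [⋀^Fin r]→ₗ[k] k => F fun i => ⟨c i, hc i⟩) h1
  rw [h b a ha, h b' a' ha', h b' a ha, h b a' ha']
  ring

/-- Modulo a subspace of dimension `r`, the determinant with `r` vectors of this subspace does not
depend on the representatives of the other vectors. -/
theorem rightForm_congr {κ : Type*} [Fintype κ] {r : ℕ} (D : B [⋀^Fin r ⊕ κ]→ₗ[k] k)
    (R : Submodule k B) [FiniteDimensional k R] (hR : finrank k R = r) {a : Fin r → B}
    (ha : ∀ i, a i ∈ R) {b b' : κ → B} (hb : ∀ j, b j - b' j ∈ R) :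
    rightForm D a b = rightForm D a b' := by
  classical
  -- One more argument in `R` makes `r + 1` vectors of `R`, which are dependent. In the expansion of
  -- `b = b' + (b - b')` below, this removes every term except the one with `b'` alone.
  have hzero : ∀ x : κ → B, (∃ j, x j ∈ R) → rightForm D a x = 0 := by
    rintro x ⟨j, hj⟩
    refine D.map_linearDependent _ fun hli => ?_
    let s : Fin r ⊕ Unit → Fin r ⊕ κ := Sum.map id fun _ => j
    have hs : Function.Injective s :=
      Function.Injective.sumMap Function.injective_id fun _ _ _ => rfl
    have h1 := hli.comp s hs
    have hmem : ∀ y, (Sum.elim a x ∘ s) y ∈ R := by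
      rintro (y | y)
      · exact ha y
      · exact hj
    have h2 : LinearIndependent k fun y => (⟨_, hmem y⟩ : R) :=
      LinearIndependent.of_comp R.subtype h1
    have h3 := h2.fintype_card_le_finrank
    rw [hR, Fintype.card_sum, Fintype.card_fin, Fintype.card_unit] at h3
    omega
  have h1 : b = b' + (b - b') := by rw [add_sub_cancel]
  rw [h1, AlternatingMap.map_add_univ, Finset.sum_eq_single Finset.univ]
  · rw [Finset.piecewise_univ]
  · intro s _ hs
    obtain ⟨j, hj⟩ : ∃ j, j ∉ s := by
      by_contra hcon
      push Not at hcon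
      exact hs (Finset.eq_univ_iff_forall.mpr hcon)
    exact hzero _ ⟨j, by rw [Finset.piecewise_eq_of_notMem _ _ _ hj]; exact hb j⟩
  · exact fun h => absurd (Finset.mem_univ _) h

end Volume

/-! ### Alternating forms on the cokernels, depending homogeneously on the linear map. -/

section CokernelForm

variable {k : Type*} [Field k]
  {A : Type*} [AddCommGroup A] [Module k A]
  {B : Type*} [AddCommGroup B] [Module k B]

/-- `U` is a family of nonzero alternating `m`-forms on the cokernels of the members of `M`, which
is homogeneous of degree `c`. -/
structure IsCokernelForm (M : Submodule k (A →ₗ[k] B)) {m : ℕ} (c : ℕ)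
    (U : (Fin m → B) → M → k) : Prop where
  isForm : ∀ b, IsForm c (U b)
  exists_form : ∀ v : M, v ≠ 0 → ∃ ω : B [⋀^Fin m]→ₗ[k] k, (∀ b, ω b = U b v) ∧ ω ≠ 0 ∧
    ∀ b b', (∀ j, b j - b' j ∈ LinearMap.range (v : A →ₗ[k] B)) → ω b = ω b'

/-- Used only over a point, where a nowhere vanishing linear form exists and shows that the degree
of a cokernel form is not determined. -/
theorem IsCokernelForm.mul_dual {M : Submodule k (A →ₗ[k] B)} {m c : ℕ}
    {U : (Fin m → B) → M → k} (hU : IsCokernelForm M c U) (l : Dual k M)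
    (hl : ∀ v, v ≠ 0 → l v ≠ 0) : IsCokernelForm M (c + 1) fun b v => U b v * l v where
  isForm b := (hU.isForm b).mul (isForm_dual l)
  exists_form v hv := by
    obtain ⟨ω, h1, h2, h3⟩ := hU.exists_form v hv
    refine ⟨l v • ω, fun b => ?_, smul_ne_zero (hl v hv) h2, fun b b' h => ?_⟩
    · rw [AlternatingMap.smul_apply, h1, smul_eq_mul, mul_comm]
    · rw [AlternatingMap.smul_apply, AlternatingMap.smul_apply, h3 b b' h]

theorem HasConstantRank.le_finrank [FiniteDimensional k B] {M : Submodule k (A →ₗ[k] B)} {r : ℕ}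
    (hM : HasConstantRank M r) (hne : M ≠ ⊥) : r ≤ finrank k B := by
  obtain ⟨f, hf, h0⟩ := M.ne_bot_iff.mp hne
  rw [← hM f hf h0]
  exact Submodule.finrank_le _

theorem exists_complement_family [FiniteDimensional k B] {R : Submodule k B} {r : ℕ}
    (hR : finrank k R = r) : ∃ b : Fin (finrank k B - r) → B, ∀ w : Fin r → B,
      LinearIndependent k w → (∀ i, w i ∈ R) → LinearIndependent k (Sum.elim w b) := by
  obtain ⟨Q, hQ⟩ := Submodule.exists_isCompl R
  have hQr : finrank k Q = finrank k B - r := by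
    have := Submodule.finrank_add_eq_of_isCompl hQ
    omega
  let t := finBasisOfFinrankEq k Q hQr
  refine ⟨fun j => t j, fun w hw hwR => LinearIndependent.sum_type hw ?_ ?_⟩
  · exact t.linearIndependent.map' (Submodule.subtype _) (Submodule.ker_subtype _)
  · refine hQ.disjoint.mono ?_ ?_
    · rw [Submodule.span_le]
      rintro _ ⟨i, rfl⟩
      exact hwR i
    · rw [Submodule.span_le]
      rintro _ ⟨j, rfl⟩
      exact (t j).2

theorem exists_adapted [FiniteDimensional k B] {f : A →ₗ[k] B} {r : ℕ}
    (hf : finrank k (LinearMap.range f) = r) :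
    ∃ (a : Fin r → A) (b : Fin (finrank k B - r) → B),
      LinearIndependent k (Sum.elim (fun i => f (a i)) b) := by
  obtain ⟨b, hb⟩ := exists_complement_family hf
  let s := finBasisOfFinrankEq k _ hf
  choose a ha using fun i => (s i).2
  refine ⟨a, b, hb _ ?_ fun i => LinearMap.mem_range_self _ _⟩
  simp only [ha]
  exact s.linearIndependent.map' (Submodule.subtype _) (Submodule.ker_subtype _)

/-- The degree counts the `r` arguments linear in `v`; the others are constant. -/
theorem isForm_det_elim [FiniteDimensional k B] {M : Submodule k (A →ₗ[k] B)} {r : ℕ} {κ : Type*} [Fintype κ]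
    (D : B [⋀^Fin r ⊕ κ]→ₗ[k] k) (a : Fin r → A) (b : κ → B) :
    IsForm r fun v : M => D (Sum.elim (fun i => (v : A →ₗ[k] B) (a i)) b) := by
  have h := IsForm.multilinear (V := M) D.toMultilinearMap (finBasis k B)
    (d := Sum.elim (fun _ => 1) (fun _ => 0))
    (L := fun x v => Sum.elim (fun i => (v : A →ₗ[k] B) (a i)) b x) (fun x j => by
      rcases x with i | i
      · let l : Dual k M := (finBasis k B).coord j ∘ₗ LinearMap.applyₗ (a i) ∘ₗ M.subtype
        exact isForm_dual l
      · exact isForm_const (V := M) ((finBasis k B).repr (b i) j))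
  simpa using h

variable [FiniteDimensional k A] [FiniteDimensional k B]

/-- The determinants formed by `r` vectors of the image of `v` and by `b` are the products of a
factor independent of `b` and of a family of forms on the cokernels. -/
theorem exists_cokernelForm [Infinite k] {M : Submodule k (A →ₗ[k] B)} {r : ℕ}
    (hM : HasConstantRank M r) (hne : M ≠ ⊥) {D : B [⋀^Fin r ⊕ Fin (finrank k B - r)]→ₗ[k] k}
    (hD : ∀ v, LinearIndependent k v → D v ≠ 0) :
    ∃ c ≤ r, ∃ (w : (Fin r → A) → M → k) (U : (Fin (finrank k B - r) → B) → M → k),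
      IsCokernelForm M c U ∧
      ∀ a b (v : M), D (Sum.elim (fun i => (v : A →ₗ[k] B) (a i)) b) = w a v * U b v := by
  let e := finBasis k B
  obtain ⟨f, hf, h0⟩ := M.ne_bot_iff.mp hne
  -- The gcd argument needs finitely many columns, so `b` is first restricted to tuples of basis
  -- vectors; multilinearity recovers all `b`.
  have hexp : ∀ (a : Fin r → B) (b : Fin (finrank k B - r) → B), D (Sum.elim a b) =
      ∑ β : Fin (finrank k B - r) → Fin (finrank k B), (∏ j, e.repr (b j) (β j)) *
        D (Sum.elim a fun j => e (β j)) :=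
    fun a b => multilinear_expand (rightForm D a).toMultilinearMap e b
  obtain ⟨a₀, b₀, hab⟩ := exists_adapted (hM f hf h0)
  have hne0 : ∃ β : Fin (finrank k B - r) → Fin (finrank k B),
      D (Sum.elim (fun i => f (a₀ i)) fun j => e (β j)) ≠ 0 := by
    by_contra hcon
    push Not at hcon
    refine hD _ hab ?_
    rw [hexp]
    exact Finset.sum_eq_zero fun β _ => by rw [hcon β, mul_zero]
  obtain ⟨β₀, hβ₀⟩ := hne0
  -- The proportionality of the determinants uses rank `r`, which fails at `v = 0`. There all the
  -- determinants vanish, because there is at least one argument in the image.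
  have hr0 : r ≠ 0 := by
    rintro rfl
    have := hM f hf h0
    rw [Submodule.finrank_eq_zero, LinearMap.range_eq_bot] at this
    exact h0 this
  obtain ⟨c, hc, w, u, hu, hwu⟩ := IsForm.exists_rank_one_factor (V := M)
    (fun (a : Fin r → A) (β : Fin (finrank k B - r) → Fin (finrank k B)) (v : M) =>
      D (Sum.elim (fun i => (v : A →ₗ[k] B) (a i)) fun j => e (β j))) (r := r)
    (fun a β => isForm_det_elim D a _)
    (fun a β a' β' v => by
      by_cases hv : v = 0
      · have hz : ∀ (x : Fin r → A) b,
            D (Sum.elim (fun i => ((0 : M) : A →ₗ[k] B) (x i)) b) = 0 :=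
          fun x b => D.map_coord_zero (.inl ⟨0, by omega⟩) (by simp)
        simp only [hv, hz, zero_mul]
      · exact det_elim_mul_comm D (LinearMap.range (v : A →ₗ[k] B))
          (hM _ v.2 (by simpa using hv)) (fun i => LinearMap.mem_range_self _ _)
          (fun i => LinearMap.mem_range_self _ _) _ _)
    (i₀ := a₀) (j₀ := β₀) (v₀ := ⟨f, hf⟩) hβ₀
  have hD' : ∀ a b (v : M), D (Sum.elim (fun i => (v : A →ₗ[k] B) (a i)) b) =
      w a v * ∑ β : Fin (finrank k B - r) → Fin (finrank k B),
        (∏ j, e.repr (b j) (β j)) * u β v := by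
    intro a b v
    rw [hexp, Finset.mul_sum]
    refine Finset.sum_congr rfl fun β _ => ?_
    rw [show D _ = _ from hwu a β v]
    ring
  refine ⟨c, hc, w, fun b v => ∑ β : Fin (finrank k B - r) → Fin (finrank k B),
    (∏ j, e.repr (b j) (β j)) * u β v, ⟨fun b => ?_, fun v hv => ?_⟩, hD'⟩
  · exact IsForm.sum _ fun β _ => (hu β).const_mul _
  · have hrank := hM _ v.2 (by simpa using hv)
    obtain ⟨a, b, hli⟩ := exists_adapted hrank
    have h1 := hD _ hli
    have hw : w a v ≠ 0 := by
      rw [hD'] at h1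
      exact left_ne_zero_of_mul h1
    refine ⟨(w a v)⁻¹ • rightForm D fun i => (v : A →ₗ[k] B) (a i), fun x => ?_, fun h => ?_,
      fun x y hxy => ?_⟩
    · change (w a v)⁻¹ * D _ = _
      rw [hD', inv_mul_cancel_left₀ hw]
    · have h2 := (smul_eq_zero.mp h).resolve_left (inv_ne_zero hw)
      exact h1 (congrArg (fun F : B [⋀^Fin (finrank k B - r)]→ₗ[k] k => F b) h2)
    · rw [AlternatingMap.smul_apply, AlternatingMap.smul_apply,
        rightForm_congr D _ hrank (fun i => LinearMap.mem_range_self _ _) hxy]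

end CokernelForm

/-! ### Constructions of morphisms of vector bundles -/

section Morphisms

variable {k : Type*} [Field k] {V : Type*} [AddCommGroup V] [Module k V]

theorem IsForm.regular_div {d : ℕ} {F G : V → k} (hF : IsForm d F) (hG : IsForm d G)
    {U : Set (ℙ k V)} (h0 : ∀ x ∈ U, G x.rep ≠ 0) :
    (fun x : ℙ k V => F x.rep / G x.rep) ∈ regularFunctions U := by
  obtain ⟨p, hp, hF⟩ := hF
  obtain ⟨q, hq, hG⟩ := hG
  exact fun x hx => ⟨d, p, q, hp, hq, hG _ ▸ h0 x hx, fun y _ _ => by simp only [hF, hG]⟩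

/-- The inverse is regular by Cramer's rule, which is the content of `frame_change`. -/
theorem isomorphic_of_bijective {e : ℕ} {E F : VecBundle k V e} (φ : Hom E F)
    (h : ∀ x, Function.Bijective (φ.toFun x)) : Isomorphic E F := by
  refine ⟨φ, ⟨fun x => (LinearEquiv.ofBijective (φ.toFun x) (h x)).symm, fun j i => ?_⟩,
    fun x => ?_, fun x => ?_⟩
  · obtain ⟨G, hG, hφ⟩ := φ.regular i j
    obtain ⟨H, hH, hh⟩ := (frame_change (Equiv.refl (Fin e)) j ((zariski k V).isOpen_inter _ _
      (E.isOpen_base i) (F.isOpen_base j)) Set.inter_subset_right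
      (fun x a => φ.toFun x (E.frame i x a)) G hG hφ).2
    have hmem : ∀ x ∈ F.base j ∩ E.base i, x ∈ {x | x ∈ E.base i ∩ F.base j ∧
        LinearIndependent k fun a => φ.toFun x (E.frame i x a)} := fun x hx =>
      ⟨⟨hx.2, hx.1⟩, (E.indep i x hx.2).map' _ (LinearMap.ker_eq_bot.mpr (h x).1)⟩
    refine ⟨H, fun b a => regular_mono hmem (hH b a), fun x hx a => ?_⟩
    rw [LinearEquiv.coe_coe, LinearEquiv.symm_apply_eq, hh x (hmem x hx) a]
    simp
  · ext v
    exact (LinearEquiv.ofBijective (φ.toFun x) (h x)).symm_apply_apply v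
  · ext v
    exact (LinearEquiv.ofBijective (φ.toFun x) (h x)).apply_symm_apply v

/-- The element of the fibre of `𝒪(d)` with a given value at the chosen vector of the line. -/
def twistMk (d : ℤ) (x : ℙ k V) : k →ₗ[k] twistFiber (k := k) d x :=
  LinearMap.toSpanSingleton k _
    (((exists_dual_rep x).choose x.rep ^ d)⁻¹ • twistFrame d (exists_dual_rep x).choose x)

theorem twistMk_apply_rep (d : ℤ) (x : ℙ k V) (t : k) : (twistMk d x t).1 (repMem x) = t := by
  change t * (((exists_dual_rep x).choose x.rep ^ d)⁻¹ * (exists_dual_rep x).choose x.rep ^ d) = t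
  rw [inv_mul_cancel₀ (zpow_ne_zero d (exists_dual_rep x).choose_spec), mul_one]

theorem bijective_of_ne_zero {E E' : Type*} [AddCommGroup E] [Module k E] [AddCommGroup E']
    [Module k E'] [FiniteDimensional k E] [FiniteDimensional k E'] (hE : finrank k E = 1)
    (hE' : finrank k E' = 1) {f : E →ₗ[k] E'} (hf : f ≠ 0) : Function.Bijective f := by
  have hr : 0 < finrank k (LinearMap.range f) := by
    rw [Nat.pos_iff_ne_zero, Ne, Submodule.finrank_eq_zero, LinearMap.range_eq_bot]
    exact hf
  have hs : Function.Surjective f := by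
    rw [← LinearMap.range_eq_top]
    exact Submodule.eq_top_of_finrank_eq
      (le_antisymm (Submodule.finrank_le _) (by omega))
  exact ⟨(LinearMap.injective_iff_surjective_of_finrank_eq_finrank (hE.trans hE'.symm)).mpr hs, hs⟩

/-- A form insensitive to `R` descends to `B ⧸ R`, here by composing with a linear section of the
quotient map. -/
theorem exists_exteriorPower_quotient {B : Type*} [AddCommGroup B] [Module k B]
    (R : Submodule k B) {m : ℕ} (ω : B [⋀^Fin m]→ₗ[k] k)
    (hω : ∀ b b', (∀ j, b j - b' j ∈ R) → ω b = ω b') :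
    ∃ Ω : ⋀[k]^m (B ⧸ R) →ₗ[k] k, ∀ b : Fin m → B,
      Ω (exteriorPower.ιMulti k m fun j => R.mkQ (b j)) = ω b := by
  obtain ⟨s, hs⟩ := R.mkQ.exists_rightInverse_of_surjective R.range_mkQ
  refine ⟨exteriorPower.alternatingMapLinearEquiv (ω.compLinearMap s), fun b => ?_⟩
  rw [exteriorPower.alternatingMapLinearEquiv_apply_ιMulti]
  refine hω _ _ fun j => ?_
  rw [← Submodule.Quotient.eq]
  exact LinearMap.congr_fun hs _

end Morphisms

/-! ### The determinant of the cokernel bundle -/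

section DetCokernel

variable {k : Type*} [Field k]
  {A : Type*} [AddCommGroup A] [Module k A] [FiniteDimensional k A]
  {B : Type*} [AddCommGroup B] [Module k B] [FiniteDimensional k B]

variable {M : Submodule k (A →ₗ[k] B)} {r : ℕ} (hM : HasConstantRank M r)

/-- The exterior product of the classes of the vectors `b j` in the cokernel. -/
def cokerWedge (x : ℙ k M) (b : Fin (finrank k B - r) → B) :
    (detBundle (cokBundle M hM)).Fiber x :=
  exteriorPower.ιMulti k (finrank k B - r)
    fun j => (LinearMap.range ((psi M).toFun x)).mkQ (b j)

/-- The constant vectors of `B` in a chart of the cokernel bundle. -/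
def cokerVectors (i : (cokBundle M hM).ι) (j : Fin (finrank k B - r)) : B :=
  let e : Basis (Fin (finrank k B)) k B := i.2.1
  ∑ m, i.2.2.2 j m • e m

/-- The form attached to `v` is a linear functional on the top exterior power of the cokernel,
nonzero and hence bijective between lines. Homogeneity of degree `c` in `v` says exactly that its
values lie in `𝒪(c)`. In a chart the frame is the wedge of the classes of constant vectors `b`, so
the coefficient is the regular function `U b / l ^ c`. -/
theorem exists_detBundle_cokBundle_hom {c : ℕ} {U : (Fin (finrank k B - r) → B) → M → k}
    (hU : IsCokernelForm M c U) :
    ∃ θ : Hom (detBundle (cokBundle M hM)) (twist k M c),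
      (∀ x, Function.Bijective (θ.toFun x)) ∧ ∀ x b v,
        (θ.toFun x (cokerWedge hM x b) : twistFiber (k := k) (V := M) c x).1 v = U b v := by
  have hex : ∀ x : ℙ k M, ∃ Ω : (detBundle (cokBundle M hM)).Fiber x →ₗ[k] k,
      Ω ≠ 0 ∧ ∀ b, Ω (cokerWedge hM x b) = U b x.rep := by
    intro x
    obtain ⟨ω, h1, h2, h3⟩ := hU.exists_form x.rep x.rep_nonzero
    obtain ⟨Ω, hΩ⟩ := exists_exteriorPower_quotient (LinearMap.range ((psi M).toFun x)) ω
      (fun b b' h => h3 b b' fun j => range_psi M x ▸ h j)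
    refine ⟨Ω, fun h => h2 ?_, fun b => (hΩ b).trans (h1 b)⟩
    refine AlternatingMap.ext fun b => (hΩ b).symm.trans ?_
    rw [h]
    rfl
  choose Ω hΩ0 hΩ using hex
  have hval : ∀ x b (v : {v : M // v ≠ 0 ∧ v ∈ x.submodule}),
      (twistMk (c : ℤ) x (Ω x (cokerWedge hM x b))).1 v = U b v := by
    intro x b v
    obtain ⟨t, _, ht⟩ := exists_smul_rep v
    rw [(twistMk (c : ℤ) x _).2 (repMem x) v t ht, twistMk_apply_rep, hΩ, ht,
      (hU.isForm b).smul, zpow_natCast]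
  refine ⟨⟨fun x => twistMk (c : ℤ) x ∘ₗ Ω x, fun i l => ?_⟩, fun x => ?_, hval⟩
  · change Dual k M at l
    refine ⟨fun _ _ x => U (cokerVectors hM i) x.rep / l x.rep ^ c, fun _ _ => ?_,
      fun x hx a => ?_⟩
    · have h1 : IsForm c fun v : M => l v ^ c := isForm_dual_pow (V := M) l c
      exact (hU.isForm _).regular_div h1 fun x hx => pow_ne_zero c hx.2
    · refine Eq.trans (twist_ext ((hval x _ (repMem x)).trans ?_)) (Fin.sum_univ_one _).symm
      change U _ x.rep = U _ x.rep / l x.rep ^ c * l x.rep ^ (c : ℤ)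
      rw [zpow_natCast, div_mul_cancel₀ _ (pow_ne_zero c hx.2)]
      rfl
  · have := (detBundle (cokBundle M hM)).finite_fiber x
    have := (twist k M c).finite_fiber x
    refine bijective_of_ne_zero (VecBundle.finrank_fiber _ x)
      ((twist k M c).finrank_fiber x) fun h => hΩ0 x ?_
    ext z
    have h1 := congrArg (fun f => (f z : twistFiber (k := k) (V := M) c x).1 (repMem x)) h
    exact (twistMk_apply_rep _ _ _).symm.trans h1

theorem isomorphic_detBundle_cokBundle {c : ℕ} {U : (Fin (finrank k B - r) → B) → M → k}
    (hU : IsCokernelForm M c U) : Isomorphic (detBundle (cokBundle M hM)) (twist k M c) := by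
  obtain ⟨θ, hθ, -⟩ := exists_detBundle_cokBundle_hom hM hU
  exact isomorphic_of_bijective θ hθ

end DetCokernel

/-! ### Comparison of degrees of families of forms and sections of line bundles. -/

section Degree

variable {k : Type*} [Field k]

theorem mem_submodule_mk {V : Type*} [AddCommGroup V] [Module k V] {v : V} (hv : v ≠ 0) :
    v ≠ 0 ∧ v ∈ (Projectivization.mk k v hv).submodule :=
  ⟨hv, by rw [Projectivization.submodule_mk]; exact Submodule.mem_span_singleton_self v⟩

theorem mk_eq_of_mem {V : Type*} [AddCommGroup V] [Module k V] {x : ℙ k V}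
    (v : {v : V // v ≠ 0 ∧ v ∈ x.submodule}) : Projectivization.mk k v.1 v.2.1 = x := by
  obtain ⟨t, ht, e⟩ := exists_smul_rep v
  conv_rhs => rw [← x.mk_rep]
  exact (Projectivization.mk_eq_mk_iff' k _ _ _ _).mpr ⟨t, e.symm⟩

/-- Two families of forms which locally differ by a regular function have the same degree. -/
theorem twist_degree_eq [IsAlgClosed k] {V : Type*} [AddCommGroup V] [Module k V] {v₁ v₂ : V}
    (hv : ∀ s t : k, s • v₁ + t • v₂ = 0 → s = 0 ∧ t = 0) {β : Type*} {c : ℕ} {d : ℤ}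
    {F : β → V → k} (hF : ∀ b, IsForm c (F b)) (hF0 : ∀ v ≠ 0, ∃ b, F b v ≠ 0)
    (s : β → ∀ x : ℙ k V, twistFiber (k := k) d x)
    (hs : ∀ x (v : {v : V // v ≠ 0 ∧ v ∈ x.submodule}), ∀ b b', F b' v.1 * (s b x).1 v = F b v.1 * (s b' x).1 v)
    (hs0 : ∀ x b, F b x.rep ≠ 0 → s b x ≠ 0)
    (hloc : ∀ x₀ : ℙ k V, ∃ (b : β) (l : Dual k V) (S : Set (ℙ k V)) (g : ℙ k V → k),
      F b x₀.rep ≠ 0 ∧ IsOpen[zariski k V] S ∧ x₀ ∈ S ∧ g ∈ regularFunctions S ∧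
      ∀ x ∈ S, l x.rep ≠ 0 ∧ s b x = g x • twistFrame d l x) : d = c := by
  have hv₁ : v₁ ≠ 0 := fun h => one_ne_zero (hv 1 0 (by rw [h, smul_zero, zero_smul, zero_add])).1
  have : Nonempty β := ⟨(hF0 v₁ hv₁).choose⟩
  choose! b hb using hF0
  have hcons : ∀ (x : ℙ k V) (v : {v : V // v ≠ 0 ∧ v ∈ x.submodule}),
      (s (b v.1) (Projectivization.mk k v.1 v.2.1)).1 ⟨v.1, mem_submodule_mk v.2.1⟩ =
        (s (b v.1) x).1 v := by
    intro x v
    obtain ⟨v, hv0, hvx⟩ := v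
    have e : Projectivization.mk k v hv0 = x := mk_eq_of_mem ⟨v, hv0, hvx⟩
    subst e
    rfl
  classical
  -- The common ratio `s b / F b`, computed at `v` with an index where `F b v ≠ 0`; by
  -- proportionality it does not depend on this index. It is homogeneous of degree `d - c`, and the
  -- value at `0` plays no role.
  let h : V → k := fun v => if hv0 : v ≠ 0 then
    (s (b v) (Projectivization.mk k v hv0)).1 ⟨v, mem_submodule_mk hv0⟩ / F (b v) v else 0
  have hh : ∀ (x : ℙ k V) (v : {v : V // v ≠ 0 ∧ v ∈ x.submodule}) (b' : β),
      h v.1 * F b' v.1 = (s b' x).1 v := by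
    intro x v b'
    simp only [h]
    rw [dif_pos v.2.1, hcons x v, div_mul_eq_mul_div, div_eq_iff (hb _ v.2.1), mul_comm,
      mul_comm _ (F _ _)]
    exact hs x v (b v.1) b'
  have hmk : ∀ v : V, v ≠ 0 → ∃ (x : ℙ k V) (w : {v : V // v ≠ 0 ∧ v ∈ x.submodule}), w.1 = v :=
    fun v hv0 => ⟨_, ⟨v, mem_submodule_mk hv0⟩, rfl⟩
  suffices hdc : d - c = 0 by omega
  refine degree_eq_zero_of_ne_zero hv (h := h) (fun v hv0 t ht => ?_) (fun v hv0 => ?_)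
    fun v hv0 => ?_
  · obtain ⟨x, w, rfl⟩ := hmk v hv0
    let w' : {v : V // v ≠ 0 ∧ v ∈ x.submodule} :=
      ⟨t • w.1, smul_ne_zero ht w.2.1, Submodule.smul_mem _ _ w.2.2⟩
    have h1 := hh x w' (b w.1)
    rw [(s (b w.1) x).2 w w' t rfl, ← hh x w, show F (b w.1) w'.1 = _ from (hF _).smul t w.1] at h1
    have h2 := hb w.1 w.2.1
    have h3 : h (t • w.1) * t ^ c = t ^ d * h w.1 :=
      mul_right_cancel₀ h2 (by linear_combination h1)
    rw [zpow_sub₀ ht, zpow_natCast, div_mul_eq_mul_div, eq_div_iff (pow_ne_zero c ht), h3]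
  · obtain ⟨x, w, rfl⟩ := hmk v hv0
    intro h0
    obtain ⟨t, ht, e⟩ := exists_smul_rep w
    have h1 := hb w.1 w.2.1
    refine hs0 x (b w.1) (fun h2 => h1 ?_) ?_
    · rw [e, (hF _).smul, ← e, h2, mul_zero]
    · have h2 := hh x w (b w.1)
      rw [h0, zero_mul, (s (b w.1) x).2 (repMem x) w t e] at h2
      refine twist_ext ?_
      exact (mul_eq_zero.mp h2.symm).resolve_left (zpow_ne_zero d ht)
  · obtain ⟨x₀, w₀, rfl⟩ := hmk v hv0
    obtain ⟨b₀, l, S, g, hb₀, hS, hx₀, hg, hsg⟩ := hloc x₀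
    obtain ⟨e, p, q, hp, hq, hqx, hpq⟩ := hg x₀ hx₀
    obtain ⟨e', q', hq', hqx', hsub⟩ := hS x₀ hx₀
    have hform : ∀ {n : ℕ} {p : MvPolynomial (Dual k V) k}, p.IsHomogeneous n →
        IsForm n (evalForm p) := fun hp => ⟨_, hp, fun _ => rfl⟩
    obtain ⟨t, ht, ew⟩ := exists_smul_rep w₀
    have hne : ∀ {n : ℕ} {F : V → k}, IsForm n F → F x₀.rep ≠ 0 → F w₀.1 ≠ 0 := by
      intro n F hF hF0
      rw [ew, hF.smul]
      exact mul_ne_zero (pow_ne_zero n ht) hF0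
    have hl : IsForm 1 fun v => l v := isForm_dual l
    -- Near `x₀` one has `s b₀ = (p / q) l ^ d`, so `h = p l ^ d / (q F b₀)`; the condition `q' ≠ 0`
    -- keeps the line inside `S`.
    have key : ∀ w ≠ 0, evalForm q w ≠ 0 → evalForm q' w ≠ 0 →
        l w ≠ 0 ∧ h w * F b₀ w * evalForm q w = evalForm p w * l w ^ d := by
      intro w hw h1 h2
      obtain ⟨x, w, rfl⟩ := hmk w hw
      obtain ⟨t, ht, ew⟩ := exists_smul_rep w
      have hrep : ∀ {n : ℕ} {F : V → k}, IsForm n F → F w.1 ≠ 0 → F x.rep ≠ 0 := by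
        intro n F hF hF0 h0
        rw [ew, hF.smul, h0, mul_zero] at hF0
        exact hF0 rfl
      have hxS := hsub x (hrep (hform hq') h2)
      obtain ⟨hlx, hsx⟩ := hsg x hxS
      have hqx := hrep (hform hq) h1
      have hgx := hpq x hxS hqx
      have h3 : (s b₀ x).1 w = g x * l w.1 ^ d := by rw [hsx]; rfl
      have h4 : evalForm p x.rep / evalForm q x.rep = evalForm p w.1 / evalForm q w.1 := by
        rw [ew, evalForm_smul hp, evalForm_smul hq, mul_div_mul_left _ _ (pow_ne_zero e ht)]
      refine ⟨?_, ?_⟩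
      · rw [ew, map_smul]
        exact mul_ne_zero ht hlx
      · rw [hh x w b₀, h3, hgx, h4]
        field_simp
    have hlw : l w₀.1 ≠ 0 :=
      (key _ w₀.2.1 (hne (hform hq) hqx) (hne (hform hq') hqx')).1
    have hb₀' := hne (hF b₀) hb₀
    -- The power of `l` belongs to the numerator or to the denominator according to the sign of `d`.
    -- Multiplying both by `q'` encodes the restriction to `S`.
    obtain ⟨m, rfl | rfl⟩ := d.eq_nat_or_neg
    · refine ⟨_, _, _, _, ((hform hp).mul (hform hq')).mul (hl.pow m),
        ((hform hq).mul (hform hq')).mul (hF b₀), ?_, fun w hw h0 => ?_⟩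
      · exact mul_ne_zero (mul_ne_zero (hne (hform hq) hqx) (hne (hform hq') hqx')) hb₀'
      · have hqq := left_ne_zero_of_mul h0
        have := (key w hw (left_ne_zero_of_mul hqq) (right_ne_zero_of_mul hqq)).2
        rw [eq_div_iff h0]
        rw [zpow_natCast] at this
        linear_combination evalForm q' w * this
    · refine ⟨_, _, _, _, (hform hp).mul (hform hq'),
        (((hform hq).mul (hform hq')).mul (hF b₀)).mul (hl.pow m), ?_, fun w hw h0 => ?_⟩
      · exact mul_ne_zero (mul_ne_zero (mul_ne_zero (hne (hform hq) hqx)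
          (hne (hform hq') hqx')) hb₀') (pow_ne_zero m hlw)
      · have hqq := left_ne_zero_of_mul (left_ne_zero_of_mul h0)
        obtain ⟨hlw', this⟩ := key w hw (left_ne_zero_of_mul hqq) (right_ne_zero_of_mul hqq)
        rw [eq_div_iff h0]
        rw [zpow_neg, zpow_natCast, eq_mul_inv_iff_mul_eq₀ (pow_ne_zero m hlw')] at this
        linear_combination evalForm q' w * this

end Degree

/-! ### The first Chern class of the cokernel bundle. -/

section Chern

variable {k : Type*} [Field k]
  {A : Type*} [AddCommGroup A] [Module k A] [FiniteDimensional k A]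
  {B : Type*} [AddCommGroup B] [Module k B] [FiniteDimensional k B]
  {M : Submodule k (A →ₗ[k] B)} {r : ℕ} (hM : HasConstantRank M r)

/-- An isomorphism to `𝒪(d)` sends the wedges of constant vectors of `B` to sections of `𝒪(d)`
proportional to the forms `U b`, which are the images of the same wedges in `𝒪(c)`. Injectivity
keeps these sections nonzero wherever `U b` is, so the degree comparison applies. -/
theorem eq_of_isomorphic_twist [IsAlgClosed k] {v₁ v₂ : M}
    (hv : ∀ s t : k, s • v₁ + t • v₂ = 0 → s = 0 ∧ t = 0) {c : ℕ}
    {U : (Fin (finrank k B - r) → B) → M → k} (hU : IsCokernelForm M c U) {d : ℤ}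
    (h : Isomorphic (detBundle (cokBundle M hM)) (twist k M d)) : d = c := by
  obtain ⟨θ, hθ, hval⟩ := exists_detBundle_cokBundle_hom hM hU
  obtain ⟨φ, ψ, hψφ, -⟩ := h
  have hφ : ∀ x, Function.Injective (φ.toFun x) := fun x z z' e => by
    have := congrArg (ψ.toFun x) e
    rwa [← LinearMap.comp_apply, ← LinearMap.comp_apply, hψφ] at this
  refine twist_degree_eq hv hU.isForm (fun v hv0 => ?_)
    (fun b x => φ.toFun x (cokerWedge hM x b)) (fun x v b b' => ?_) (fun x b hb h0 => hb ?_)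
    fun x₀ => ?_
  · obtain ⟨ω, h1, h2, -⟩ := hU.exists_form v hv0
    by_contra hcon
    push Not at hcon
    exact h2 (AlternatingMap.ext fun b => (h1 b).trans (hcon b))
  · obtain ⟨t, ht, e⟩ := exists_smul_rep v
    have h1 : U b' x.rep • cokerWedge hM x b = U b x.rep • cokerWedge hM x b' := by
      refine (hθ x).1 ?_
      rw [map_smul, map_smul]
      refine twist_ext ?_
      change U b' x.rep * (θ.toFun x (cokerWedge hM x b) :
        twistFiber (k := k) (V := M) c x).1 (repMem x) = U b x.rep *
        (θ.toFun x (cokerWedge hM x b') : twistFiber (k := k) (V := M) c x).1 (repMem x)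
      rw [hval, hval]
      exact mul_comm _ _
    have h2 := congrArg (φ.toFun x) h1
    rw [map_smul, map_smul] at h2
    have h3 : U b' x.rep * (φ.toFun x (cokerWedge hM x b) :
        twistFiber (k := k) (V := M) d x).1 v = U b x.rep *
        (φ.toFun x (cokerWedge hM x b') : twistFiber (k := k) (V := M) d x).1 v :=
      congrArg (fun z : twistFiber (k := k) (V := M) d x => z.1 v) h2
    rw [e, (hU.isForm _).smul, (hU.isForm _).smul, mul_assoc, mul_assoc, h3]
  · have h1 := hφ x (h0.trans (map_zero _).symm)
    have h2 := hval x b (repMem x)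
    rw [h1, map_zero] at h2
    exact h2.symm
  · obtain ⟨i, hi⟩ := (detBundle (cokBundle M hM)).cover x₀
    obtain ⟨l, hl⟩ := exists_dual_rep x₀
    obtain ⟨G, hG, h1⟩ := φ.regular i l
    refine ⟨cokerVectors hM i, l, _, G 0 0, fun h0 => ?_, (zariski k M).isOpen_inter _ _
      ((detBundle (cokBundle M hM)).isOpen_base i) ((twist k M d).isOpen_base l), ⟨hi, hl⟩,
      hG 0 0, fun x hx => ⟨hx.2, (h1 x hx 0).trans (Fin.sum_univ_one _)⟩⟩
    refine ((detBundle (cokBundle M hM)).indep i x₀ hi).ne_zero 0 ((hθ x₀).1 ?_)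
    rw [map_zero]
    exact twist_ext ((hval x₀ _ (repMem x₀)).trans h0)

theorem isomorphic_twist_iff [IsAlgClosed k] {v₁ v₂ : M}
    (hv : ∀ s t : k, s • v₁ + t • v₂ = 0 → s = 0 ∧ t = 0) {c : ℕ}
    {U : (Fin (finrank k B - r) → B) → M → k} (hU : IsCokernelForm M c U) (d : ℤ) :
    Isomorphic (detBundle (cokBundle M hM)) (twist k M d) ↔ d = c :=
  ⟨eq_of_isomorphic_twist hM hv hU, fun h => h ▸ isomorphic_detBundle_cokBundle hM hU⟩

theorem c₁_cokBundle [IsAlgClosed k] {v₁ v₂ : M}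
    (hv : ∀ s t : k, s • v₁ + t • v₂ = 0 → s = 0 ∧ t = 0) {c : ℕ}
    {U : (Fin (finrank k B - r) → B) → M → k} (hU : IsCokernelForm M c U) :
    c₁ (cokBundle M hM) = c := by
  have h : ∃! d : ℤ, Isomorphic (detBundle (cokBundle M hM)) (twist k M d) :=
    ⟨c, (isomorphic_twist_iff hM hv hU c).mpr rfl, fun d => (isomorphic_twist_iff hM hv hU d).mp⟩
  rw [c₁, dif_pos h]
  exact (isomorphic_twist_iff hM hv hU _).mp h.choose_spec.1

/-- On a point, a nonzero linear form on `M` has no zero on `M ∖ {0}`. Multiplying `U` by it gives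
isomorphisms with both `𝒪(c)` and `𝒪(c + 1)`; uniqueness fails and `c₁` takes its default value. -/
theorem c₁_cokBundle_of_finrank_eq_one (h1 : finrank k M = 1) {c : ℕ}
    {U : (Fin (finrank k B - r) → B) → M → k} (hU : IsCokernelForm M c U) :
    c₁ (cokBundle M hM) = 0 := by
  have h : ¬ ∃! d : ℤ, Isomorphic (detBundle (cokBundle M hM)) (twist k M d) := by
    rintro ⟨d, -, hd⟩
    let e : Basis (Fin 1) k M := finBasisOfFinrankEq k M h1
    have hU' := hU.mul_dual (e.coord 0) fun v hv0 h0 => hv0 <| e.ext_elem fun i => by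
      rw [Subsingleton.elim i 0, map_zero e.repr]
      exact h0
    have h2 := hd _ (isomorphic_detBundle_cokBundle hM hU)
    have h3 := hd _ (isomorphic_detBundle_cokBundle hM hU')
    push_cast at h3
    omega
  rw [c₁, dif_neg h]

end Chern

/-! ### The image bundle on a line -/

section Proportional

variable {k : Type*} [Field k] {V : Type*} [AddCommGroup V] [Module k V]

/-- The section of `𝒪(d)` given by a form of degree `d`. -/
def IsForm.toTwist {d : ℕ} {F : V → k} (hF : IsForm d F) (x : ℙ k V) :
    twistFiber (k := k) (d : ℤ) x :=
  ⟨fun v => F v.1, fun v w t e => by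
    change F w.1 = t ^ (d : ℤ) * F v.1
    rw [e, hF.smul, zpow_natCast]⟩

/-- Proportional families of forms without common zeros differ by a nowhere vanishing function,
whose degree is zero; the second family is seen as sections of `𝒪(c')`. -/
theorem degree_eq_of_proportional [IsAlgClosed k] {v₁ v₂ : V}
    (hv : ∀ s t : k, s • v₁ + t • v₂ = 0 → s = 0 ∧ t = 0) {β : Type*} {c c' : ℕ}
    {F F' : β → V → k} (hF : ∀ b, IsForm c (F b)) (hF' : ∀ b, IsForm c' (F' b))
    (hF0 : ∀ v ≠ 0, ∃ b, F b v ≠ 0) (hF0' : ∀ v ≠ 0, ∃ b, F' b v ≠ 0)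
    (h : ∀ v ≠ 0, ∀ b b', F b' v * F' b v = F b v * F' b' v) : c' = c := by
  have h1 := twist_degree_eq hv (d := c') hF hF0 (fun b x => (hF' b).toTwist x)
    (fun x v b b' => h v.1 v.2.1 b b') (fun x b hb h0 => ?_) fun x₀ => ?_
  · exact_mod_cast h1
  · obtain ⟨b', hb'⟩ := hF0' x.rep x.rep_nonzero
    have h2 : F' b x.rep = 0 := congrFun (congrArg Subtype.val h0) (repMem x)
    have h3 := h x.rep x.rep_nonzero b b'
    rw [h2, mul_zero] at h3
    exact mul_ne_zero hb hb' h3.symm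
  · obtain ⟨b, hb⟩ := hF0 x₀.rep x₀.rep_nonzero
    obtain ⟨l, hl⟩ := exists_dual_rep x₀
    refine ⟨b, l, _, _, hb, (twist k V c').isOpen_base l, hl,
      (hF' b).regular_div (isForm_dual_pow l c') fun x hx => pow_ne_zero c' hx,
      fun x hx => ⟨hx, twist_ext ?_⟩⟩
    change F' b x.rep = F' b x.rep / l x.rep ^ c' * l x.rep ^ (c' : ℤ)
    rw [zpow_natCast, div_mul_cancel₀ _ (pow_ne_zero c' hx)]

end Proportional

/-! ### Frames of the image along a line, and their degree. -/

section Image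

/-- Regular dependence, on each chart, of the coordinates of a vector of the image on its
coordinates in the target; this makes a map into the image regular as soon as it is regular into the
target. -/
theorem exists_imFrame_coeff {k : Type*} [Field k] {V : Type*} [AddCommGroup V] [Module k V]
    {e f : ℕ} {E : VecBundle k V e} {F : VecBundle k V f} (φ : Hom E F) {r : ℕ}
    (hφ : ∀ x, finrank k (LinearMap.range (φ.toFun x)) = r) (j : AdaptedIndex E F r) :
    ∃ H : Fin r → Fin f → ℙ k V → k, (∀ a m, H a m ∈ regularFunctions (adBase φ j)) ∧
      ∀ x ∈ adBase φ j, ∀ (s : Fin f → k) (z : LinearMap.range (φ.toFun x)),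
        (z : F.Fiber x) = ∑ m, s m • F.frame j.2.1 x m →
        z = ∑ a, (∑ m, H a m x * s m) • imFrame φ j x a := by
  by_cases hr : r ≤ f
  · obtain ⟨G, hG, h⟩ := adSec_regular φ j
    have ε : Fin r ⊕ Fin (f - r) ≃ Fin f := finSumFinEquiv.trans (finCongr (by omega))
    obtain ⟨H, hH, hh⟩ := (frame_change ε j.2.1 ((zariski k V).isOpen_inter _ _
      (E.isOpen_base _) (F.isOpen_base _)) Set.inter_subset_right _ G hG h).2
    refine ⟨fun a m => H (.inl a) m, fun a m => hH _ _, fun x hx s z hz => ?_⟩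
    have h1 : z ∈ Submodule.span k (Set.range (imFrame φ j x)) := by
      rw [imFrame_span φ hφ j hx]; trivial
    obtain ⟨c, hc⟩ := (Submodule.mem_span_range_iff_exists_fun k).mp h1
    have h2 : (z : F.Fiber x) = ∑ a, (Sum.elim c 0 : _ → k) a • adSec φ j x a := by
      rw [Fintype.sum_sum_type]
      have := congrArg Subtype.val hc
      simp only [AddSubmonoidClass.coe_finsetSum, SetLike.val_smul] at this
      simp only [Sum.elim_inl, Sum.elim_inr, Pi.zero_apply, zero_smul, Finset.sum_const_zero,
        add_zero]
      exact this.symm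
    have h3 : (z : F.Fiber x) = ∑ a, (∑ m, H a m x * s m) • adSec φ j x a := by
      rw [hz]
      simp only [hh x hx, Finset.smul_sum, smul_smul, Finset.sum_smul]
      rw [Finset.sum_comm]
      simp only [mul_comm]
    have h4 := hx.2.eq_coords_of_eq (h3.symm.trans h2)
    rw [← hc]
    exact Finset.sum_congr rfl fun a _ => congrArg (· • imFrame φ j x a) (h4 (.inl a)).symm
  · exact ⟨0, fun a m => Subalgebra.zero_mem _, fun x _ => absurd (rank_le φ x (hφ x)) hr⟩

variable {k : Type*} [Field k]
  {A : Type*} [AddCommGroup A] [Module k A]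
  {B : Type*} [AddCommGroup B] [Module k B]

theorem range_incl_rep {M : Submodule k (A →ₗ[k] B)} (W : Submodule k M) (y : ℙ k W) :
    LinearMap.range ((incl W y).rep : A →ₗ[k] B) =
      LinearMap.range ((y.rep : M) : A →ₗ[k] B) := by
  obtain ⟨t, ht, h⟩ := rep_map y
  rw [incl, h, Submodule.coe_smul, LinearMap.range_smul _ _ ht]

/-- The vectors which span the image of `v`: the images of fixed vectors, and fixed vectors. -/
def pencilFrame {r : ℕ} (c : ℕ) (α : Fin r → A) (β : Fin r → B) (v : A →ₗ[k] B) (i : Fin r) : B :=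
  if (i : ℕ) < c then v (α i) else β i

variable {M : Submodule k (A →ₗ[k] B)} {r : ℕ}

theorem isForm_pencilFrame (W : Submodule k M) (c : ℕ) (α : Fin r → A) (β : Fin r → B)
    {κ : Type*} (e : Basis κ k B) (i : Fin r) (m : κ) :
    IsForm (if (i : ℕ) < c then 1 else 0)
      fun v : W => e.repr (pencilFrame c α β v.1.1 i) m := by
  unfold pencilFrame
  split_ifs with h
  · let l : Dual k W := e.coord m ∘ₗ LinearMap.applyₗ (α i) ∘ₗ M.subtype ∘ₗ W.subtype
    exact isForm_dual (V := W) l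
  · exact isForm_const (V := W) (e.repr (β i) m)

variable [FiniteDimensional k A] [FiniteDimensional k B]

theorem exists_line_frame [Infinite k] (hM : HasConstantRank M r) {W : Submodule k M}
    (hW : finrank k W = 2) : ∃ c ≤ r, ∃ (α : Fin r → A) (β : Fin r → B), ∀ v : W, v ≠ 0 →
      LinearIndependent k (pencilFrame c α β v.1.1) ∧
      ∀ i, pencilFrame c α β v.1.1 i ∈ LinearMap.range ((v : M) : A →ₗ[k] B) := by
  have hW' : finrank k (W.map M.subtype) = 2 := by
    rw [← hW]
    exact (Submodule.equivMapOfInjective _ M.subtype_injective W).finrank_eq.symm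
  have hr : HasConstantRank (W.map M.subtype) r := by
    rintro _ ⟨f, -, rfl⟩ h0
    exact hM _ f.2 h0
  obtain ⟨c, hc, α, β, h⟩ := exists_pencil_frame hW' hr
  exact ⟨c, hc, α, β, fun v hv => h _ ⟨v, v.2, rfl⟩ fun h0 => hv (Subtype.ext (Subtype.ext h0))⟩

/-- On `W`, the determinants of `D` formed with the pencil frame have degree `c'`, one for each
frame vector linear in `v`. For each `v` the frame spans the same image as the vectors `v (a i)`, so
these determinants are proportional to `w a v * U b v`, and cancelling `w a v ≠ 0` makes them
proportional to `U b`. -/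
theorem line_degree_eq [IsAlgClosed k] (hM : HasConstantRank M r) {W : Submodule k M} {v₁ v₂ : W}
    (hv : ∀ s t : k, s • v₁ + t • v₂ = 0 → s = 0 ∧ t = 0) {c' : ℕ} (hc' : c' ≤ r)
    {α : Fin r → A} {β : Fin r → B}
    (hαβ : ∀ v : W, v ≠ 0 → LinearIndependent k (pencilFrame c' α β v.1.1) ∧
      ∀ i, pencilFrame c' α β v.1.1 i ∈ LinearMap.range ((v : M) : A →ₗ[k] B))
    {D : B [⋀^Fin r ⊕ Fin (finrank k B - r)]→ₗ[k] k}
    (hD : ∀ v, LinearIndependent k v → D v ≠ 0) {c : ℕ} {w : (Fin r → A) → M → k}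
    {U : (Fin (finrank k B - r) → B) → M → k} (hU : IsCokernelForm M c U)
    (hwU : ∀ a b (v : M), D (Sum.elim (fun i => (v : A →ₗ[k] B) (a i)) b) = w a v * U b v) :
    c = c' := by
  have hrank : ∀ v : W, v ≠ 0 → finrank k (LinearMap.range ((v : M) : A →ₗ[k] B)) = r :=
    fun v hv0 => hM _ (v : M).2 fun h0 => hv0 (Subtype.ext (Subtype.ext h0))
  have hcomm : ∀ v : W, v ≠ 0 → ∃ (a : Fin r → A) (b₀ : Fin (finrank k B - r) → B),
      D (Sum.elim (fun i => ((v : M) : A →ₗ[k] B) (a i)) b₀) ≠ 0 ∧ ∀ b b',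
      D (Sum.elim (pencilFrame c' α β v.1.1) b) * (w a v * U b' v) =
        D (Sum.elim (pencilFrame c' α β v.1.1) b') * (w a v * U b v) := by
    intro v hv0
    obtain ⟨a, b₀, hab⟩ := exists_adapted (hrank v hv0)
    refine ⟨a, b₀, hD _ hab, fun b b' => ?_⟩
    rw [← hwU, ← hwU]
    exact det_elim_mul_comm D _ (hrank v hv0) (hαβ v hv0).2
      (fun i => LinearMap.mem_range_self _ _) b b'
  refine degree_eq_of_proportional (V := W) hv
    (F := fun b v => D (Sum.elim (pencilFrame c' α β v.1.1) b)) (F' := fun b v => U b v)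
    (fun b => ?_) (fun b => (hU.isForm b).restrict W) (fun v hv0 => ?_) (fun v hv0 => ?_)
    fun v hv0 b b' => ?_
  · have h := IsForm.multilinear (V := W) D.toMultilinearMap (finBasis k B)
      (d := Sum.elim (fun i : Fin r => if (i : ℕ) < c' then 1 else 0) (fun _ => 0))
      (L := fun x v => Sum.elim (pencilFrame c' α β v.1.1) b x) (fun x m => by
        rcases x with i | j
        · exact isForm_pencilFrame W c' α β _ i m
        · exact isForm_const (V := W) ((finBasis k B).repr (b j) m))
    -- The count of the indices below `c'` is `c'` only because `c' ≤ r`.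
    have hcard : ∑ i : Fin r, (if (i : ℕ) < c' then 1 else 0) = c' := by
      rw [Finset.sum_boole, Fin.card_filter_val_lt]
      simpa using hc'
    simpa [hcard] using h
  · obtain ⟨b, hb⟩ := exists_complement_family (hrank v hv0)
    exact ⟨b, hD _ (hb _ (hαβ v hv0).1 (hαβ v hv0).2)⟩
  · obtain ⟨a, b₀, h0, -⟩ := hcomm v hv0
    rw [hwU] at h0
    exact ⟨b₀, right_ne_zero_of_mul h0⟩
  · obtain ⟨a, b₀, h0, h⟩ := hcomm v hv0
    rw [hwU] at h0
    refine mul_left_cancel₀ (left_ne_zero_of_mul h0) ?_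
    linear_combination -(h b b')

end Image

/-! ### Splitting of the image bundle on a line. -/

section LineHom

variable {k : Type*} [Field k] {V : Type*} [AddCommGroup V] [Module k V]

theorem Isomorphic.symm {e f : ℕ} {E : VecBundle k V e} {F : VecBundle k V f}
    (h : Isomorphic E F) : Isomorphic F E := by
  obtain ⟨φ, ψ, h1, h2⟩ := h
  exact ⟨ψ, φ, h2, h1⟩

/-- A morphism to the restriction of the target of `φ` with values in the image of `φ` is a morphism
to the restriction of the image bundle of `φ`. -/
def Hom.liftImage {e f g : ℕ} {E : VecBundle k V e} {F : VecBundle k V f} (φ : Hom E F) {r : ℕ}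
    (hφ : ∀ x, finrank k (LinearMap.range (φ.toFun x)) = r) {W : Submodule k V}
    {D : VecBundle k W g} (θ : Hom D (restrict F W))
    (h : ∀ y z, θ.toFun y z ∈ LinearMap.range (φ.toFun (incl W y))) :
    Hom D (restrict (imageBundle φ hφ) W) where
  toFun y := LinearMap.codRestrict (LinearMap.range (φ.toFun (incl W y))) (θ.toFun y) (h y)
  regular i j := by
    change AdaptedIndex E F r at j
    obtain ⟨S, hS, hθ⟩ := θ.regular i j.2.1
    obtain ⟨H, hH, hh⟩ := exists_imFrame_coeff φ hφ j
    refine ⟨fun a b y => ∑ m, (H a m ∘ incl W) y * S m b y, fun a b => ?_, fun y hy b => ?_⟩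
    · refine regular_sum_mul (fun m => ?_) (fun m => ?_)
      · exact regular_mono (fun y hy => hy.2) (regular_comp_incl W (hH a m))
      · exact regular_mono (U := D.base i ∩ (restrict F W).base j.2.1)
          (fun y hy => ⟨hy.1, hy.2.1.2⟩) (hS m b)
    · have hy' : y ∈ D.base i ∩ (restrict F W).base j.2.1 := ⟨hy.1, hy.2.1.2⟩
      exact hh (incl W y) hy.2 (fun m => S m b y)
        (⟨θ.toFun y (D.frame i y b), h y _⟩ : LinearMap.range (φ.toFun (incl W y)))
        (hθ y hy' b)

/-- The combination of given vectors of `B` with coefficients in the fibres of the `𝒪(dᵢ)`. -/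
def formMap {B : Type*} [AddCommGroup B] [Module k B] {r : ℕ} (d : Fin r → ℤ) (y : ℙ k V)
    (w : Fin r → B) : (∀ i, twistFiber (k := k) (d i) y) →ₗ[k] B where
  toFun η := ∑ i, (η i).1 (repMem y) • w i
  map_add' η η' := by
    rw [← Finset.sum_add_distrib]
    exact Finset.sum_congr rfl fun i _ => add_smul _ _ _
  map_smul' t η := by
    rw [RingHom.id_apply, Finset.smul_sum]
    exact Finset.sum_congr rfl fun i _ => mul_smul _ _ _

/-- The morphism from a sum of line bundles `𝒪(-δᵢ)` to a trivial bundle given by vectors whose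
coordinates are forms of degree `δᵢ`. -/
def formHom {B : Type*} [AddCommGroup B] [Module k B] [FiniteDimensional k B] (W : Submodule k V)
    {r : ℕ} (d : Fin r → ℤ) (δ : Fin r → ℕ) (hd : ∀ i, d i = -(δ i : ℤ)) (w : Fin r → W → B)
    (hw : ∀ (e : Basis (Fin (finrank k B)) k B) i m, IsForm (δ i) fun v => e.repr (w i v) m) :
    Hom (directSum fun i => twist k W (d i)) (restrict (trivialBundle k V B) W) where
  toFun y := formMap d y fun i => w i y.rep
  regular l e := by
    change ∀ i : Fin r, Dual k W at l
    change Basis (Fin (finrank k B)) k B at e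
    refine ⟨fun m a y => e.repr (w a y.rep) m / l a y.rep ^ δ a, fun m a => ?_, fun y hy a => ?_⟩
    · exact (hw e a m).regular_div (isForm_dual_pow (l a) (δ a)) fun y hy =>
        pow_ne_zero _ (hy.1 a)
    · change ∑ i, ((Pi.single a (twistFrame (d a) (l a) y) :
        ∀ i, twistFiber (k := k) (V := W) (d i) y) i).1 (repMem y) • w i y.rep =
        ∑ m, (e.repr (w a y.rep) m / l a y.rep ^ δ a) • e m
      rw [Finset.sum_eq_single a]
      · rw [Pi.single_eq_same]
        change (l a y.rep ^ d a) • w a y.rep = _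
        conv_lhs => rw [← e.sum_repr (w a y.rep)]
        rw [Finset.smul_sum]
        refine Finset.sum_congr rfl fun m _ => ?_
        rw [smul_smul, hd, zpow_neg, zpow_natCast, div_eq_inv_mul]
      · intro i _ hi
        rw [Pi.single_eq_of_ne hi]
        exact zero_smul _ _
      · exact fun h => absurd (Finset.mem_univ _) h

/-- The restriction of the image of `φ` to a linear subspace is a sum of line bundles if its fibres
have bases formed by homogeneous vectors of `B`. -/
theorem restrict_imageBundle_isomorphic {B : Type*} [AddCommGroup B] [Module k B]
    [FiniteDimensional k B] {e r : ℕ} {E : VecBundle k V e} (φ : Hom E (trivialBundle k V B))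
    (hφ : ∀ x, finrank k (LinearMap.range (φ.toFun x)) = r) (W : Submodule k V)
    (d : Fin r → ℤ) (δ : Fin r → ℕ) (hd : ∀ i, d i = -(δ i : ℤ)) (w : Fin r → W → B)
    (hw : ∀ (e : Basis (Fin (finrank k B)) k B) i m, IsForm (δ i) fun v => e.repr (w i v) m)
    (hli : ∀ y : ℙ k W, LinearIndependent k fun i => w i y.rep)
    (hmem : ∀ (y : ℙ k W) i, w i y.rep ∈ LinearMap.range (φ.toFun (incl W y))) :
    Isomorphic (restrict (imageBundle φ hφ) W) (directSum fun i => twist k W (d i)) := by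
  let θ := formHom W d δ hd w hw
  have hθ : ∀ y z, θ.toFun y z ∈ LinearMap.range (φ.toFun (incl W y)) := by
    intro y z
    change ∀ i, twistFiber (k := k) (V := W) (d i) y at z
    exact Submodule.sum_mem (LinearMap.range (φ.toFun (incl W y))) (t := Finset.univ)
      (f := fun i => (z i).1 (repMem y) • w i y.rep) fun i _ => Submodule.smul_mem _ _ (hmem y i)
  refine (isomorphic_of_bijective (φ.liftImage hφ θ hθ) fun y => ?_).symm
  have := (directSum fun i => twist k W (d i)).finite_fiber y
  have := (restrict (imageBundle φ hφ) W).finite_fiber y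
  -- An element of the fibre of `𝒪(d i)` is determined by its value at the representative, and these
  -- values are the coefficients of an independent family. Equality of ranks then gives bijectivity.
  have hinj : Function.Injective ((φ.liftImage hφ θ hθ).toFun y) := by
    refine (injective_iff_map_eq_zero _).mpr fun η hη => ?_
    change ∀ i, twistFiber (k := k) (V := W) (d i) y at η
    have h0 : (∑ i, (η i).1 (repMem y) • w i y.rep : B) = 0 := congrArg Subtype.val hη
    have h1 := Fintype.linearIndependent_iff.mp (hli y) _ h0
    exact funext fun i => twist_ext (h1 i)
  exact ⟨hinj, (LinearMap.injective_iff_surjective_of_finrank_eq_finrank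
    ((VecBundle.finrank_fiber _ y).trans (VecBundle.finrank_fiber _ y).symm)).mp hinj⟩

theorem exists_pair_of_two_le_finrank (h : 2 ≤ finrank k V) :
    ∃ v₁ v₂ : V, ∀ s t : k, s • v₁ + t • v₂ = 0 → s = 0 ∧ t = 0 := by
  have hfin : FiniteDimensional k V := Module.finite_of_finrank_pos (by omega)
  let e := finBasis k V
  obtain ⟨i, j, hij⟩ : ∃ i j : Fin (finrank k V), i ≠ j :=
    ⟨⟨0, by omega⟩, ⟨1, by omega⟩, by simp⟩
  refine ⟨e i, e j, fun s t h => ?_⟩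
  have h' := fun m => congrArg (fun v => e.repr v m) h
  simp only [map_add, map_smul, map_zero, Basis.repr_self, Finsupp.add_apply, Finsupp.smul_apply,
    Finsupp.zero_apply, smul_eq_mul] at h'
  have hi := h' i
  have hj := h' j
  rw [Finsupp.single_eq_same, Finsupp.single_eq_of_ne hij] at hi
  rw [Finsupp.single_eq_same, Finsupp.single_eq_of_ne hij.symm] at hj
  exact ⟨by simpa using hi, by simpa using hj⟩

end LineHom

end ProjSpace

end

/-! ### The Chern class bounds and the splitting on lines. -/

theorem mainTheorem8 {k : Type*} [Field k] [IsAlgClosed k] [CharZero k]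
    {A : Type*} [AddCommGroup A] [Module k A] [FiniteDimensional k A]
    {B : Type*} [AddCommGroup B] [Module k B] [FiniteDimensional k B]
    (M : Submodule k (A →ₗ[k] B)) (n r : ℕ) (hn : finrank k M = n + 1)
    (hM : ProjSpace.HasConstantRank M r) :
    (1 ≤ n → ∀ d : ℤ,
      ProjSpace.Isomorphic (ProjSpace.detBundle (ProjSpace.cokBundle M hM))
        (ProjSpace.twist k M d) ↔ d = ProjSpace.c₁ (ProjSpace.cokBundle M hM)) ∧
    0 ≤ ProjSpace.c₁ (ProjSpace.cokBundle M hM) ∧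
    ProjSpace.c₁ (ProjSpace.cokBundle M hM) ≤ r ∧
    ProjSpace.IsUniformOfType (ProjSpace.imBundle M hM)
      (fun i : Fin r => if (i : ℤ) < ProjSpace.c₁ (ProjSpace.cokBundle M hM) then -1 else 0) := by
  have : Infinite k := IsAlgClosed.instInfinite
  have hne : M ≠ ⊥ := fun e => by rw [e, finrank_bot] at hn; omega
  obtain ⟨D, hD⟩ := ProjSpace.exists_volume (hM.le_finrank hne)
  obtain ⟨c, hc, w, U, hU, hwU⟩ := ProjSpace.exists_cokernelForm hM hne hD
  rcases Nat.eq_zero_or_pos n with rfl | hpos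
  · rw [ProjSpace.c₁_cokBundle_of_finrank_eq_one hM hn hU]
    -- A one-dimensional `M` has no two-dimensional subspace, so uniformity is vacuous.
    refine ⟨fun h => by omega, le_rfl, by positivity, fun W hW => ?_⟩
    have := W.finrank_le
    omega
  · obtain ⟨v₁, v₂, hv⟩ := ProjSpace.exists_pair_of_two_le_finrank (k := k) (V := M) (by omega)
    rw [ProjSpace.c₁_cokBundle hM hv hU]
    refine ⟨fun _ d => ProjSpace.isomorphic_twist_iff hM hv hU d, by positivity,
      by exact_mod_cast hc, fun W hW => ?_⟩
    obtain ⟨c', hc', α, β, hαβ⟩ := ProjSpace.exists_line_frame hM hW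
    obtain ⟨w₁, w₂, hw⟩ := ProjSpace.exists_pair_of_two_le_finrank (k := k) (V := W) hW.ge
    -- The number of linear vectors in the frame of this particular line is the global degree `c`,
    -- so the splitting type is the same on all lines.
    obtain rfl := ProjSpace.line_degree_eq hM hw hc' hαβ hD hU hwU
    refine ProjSpace.restrict_imageBundle_isomorphic (ProjSpace.psi M) hM.finrank_range_psi W _
      (fun i => if (i : ℕ) < c then 1 else 0) (fun i => ?_)
      (fun i v => ProjSpace.pencilFrame c α β v.1.1 i)
      (fun e i m => ProjSpace.isForm_pencilFrame W c α β e i m)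
      (fun y => (hαβ y.rep y.rep_nonzero).1) fun y i => ?_
    · simp only [Nat.cast_lt]
      split_ifs <;> simp
    · rw [ProjSpace.range_psi, ProjSpace.range_incl_rep]
      exact (hαβ y.rep y.rep_nonzero).2 i
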